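/- Fix an integer $k\ge 0$. An instance consists of a set $A=\{a_1,\dots,a_n\}$ of $n$ agents, a set $I$ of $m=kn$ items, a profile $P=(P_1,\dots,P_n)$ of linear orders over $I$ (the preferences of the agents), and a distinguished agent $a_j\in A$; here $n$ is part of the input, while $k$ is a constant. A policy is a sequence of $m$ agents; the agents take turns in this order, and an agent whose turn it is gets the item that she prefers most among the items not yet allocated. A policy is balanced if every agent has the same number of turns. Consider the following decision problems. - NecessaryItem (for balanced policies): given $(A,I,P,a_j,o)$ with $o\in I$, does $a_j$ get $o$ under every balanced policy? - NecessarySet (for balanced policies): given $(A,I,P,a_j,I')$ with $I'\subseteq I$, is the set of items that $a_j$ gets equal to $I'$ under every balanced policy? - NecessarySubset (for balanced policies): given $(A,I,P,a_j,I')$ with $I'\subseteq I$, does $a_j$ get all items of $I'$ under every balanced policy? For every constant $k$, each of these three problems is in P: there is a Turing machine that, started on the (standard) string encoding of any instance, halts with the correct answer after a number of steps that is bounded by a polynomial in the length of the encoding. -/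

import Mathlib

/-! ### Sequential allocation

Agents are the elements of `Fin n` and items the elements of `Fin m`.  A linear order over the items
is given by its ranking `P : Fin m ≃ Fin m`: the item at position `i` (position `0` is the best one)
is `P i`, and `c` is preferred to `d` iff `P.symm c < P.symm d`.  A profile is one ranking for every
agent.  A policy is the list of the agents in the order of their turns. -/

namespace SeqAlloc

/-- The items from the most preferred to the least preferred one. -/
def prefList {m : ℕ} (P : Equiv.Perm (Fin m)) : List (Fin m) :=
  List.ofFn P

/-- The most preferred item among the available items `S` (`none` if there is none). -/
def favourite {m : ℕ} (P : Equiv.Perm (Fin m)) (S : Finset (Fin m)) : Option (Fin m) :=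
  (prefList P).find? (fun c => decide (c ∈ S))

/-- The picks `(agent, item)`, in order, when the agents take the turns of the policy one after
the other and `S` is the set of the items available at the beginning: the agent whose turn it is
takes her most preferred available item. -/
def picks {n m : ℕ} (P : Fin n → Equiv.Perm (Fin m)) :
    List (Fin n) → Finset (Fin m) → List (Fin n × Fin m)
  | [], _ => []
  | a :: π, S =>
    match favourite (P a) S with
    | none => picks P π S
    | some c => (a, c) :: picks P π (S.erase c)

/-- The set of items that agent `j` gets under the policy `π`. -/
def bundle {n m : ℕ} (P : Fin n → Equiv.Perm (Fin m)) (π : List (Fin n)) (j : Fin n) :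
    Finset (Fin m) :=
  Finset.univ.filter (fun c => (j, c) ∈ picks P π Finset.univ)

/-- A balanced policy: it has `m` turns, one for each item, and all agents have the same number
of turns. -/
def IsBalancedPolicy {n : ℕ} (m : ℕ) (π : List (Fin n)) : Prop :=
  π.length = m ∧ ∀ a b : Fin n, π.count a = π.count b

/-- An allocation instance `(A, I, P, a_j)` with a distinguished agent, where the number of items is
`k` times the number of agents. -/
structure Instance (k : ℕ) where
  /-- the number of agents -/
  n : ℕ
  /-- the preference profile -/
  profile : Fin n → Equiv.Perm (Fin (k * n))
  /-- the distinguished agent -/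
  agent : Fin n

/-- An instance `(A, I, P, a_j, o)` with a distinguished item `o`. -/
structure ItemInstance (k : ℕ) extends Instance k where
  /-- the distinguished item -/
  item : Fin (k * n)

/-- An instance `(A, I, P, a_j, I')` with a distinguished set of items `I'`. -/
structure SetInstance (k : ℕ) extends Instance k where
  /-- the distinguished set of items -/
  items : Finset (Fin (k * n))

/-- Does the distinguished agent get the distinguished item under all balanced policies? -/
def NecessaryItem {k : ℕ} (x : ItemInstance k) : Prop :=
  ∀ π : List (Fin x.n), IsBalancedPolicy (k * x.n) π → x.item ∈ bundle x.profile π x.agent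

/-- Does the distinguished agent get exactly the distinguished set under all balanced policies? -/
def NecessarySet {k : ℕ} (x : SetInstance k) : Prop :=
  ∀ π : List (Fin x.n), IsBalancedPolicy (k * x.n) π → bundle x.profile π x.agent = x.items

/-- Does the distinguished agent get all items of the distinguished set under all balanced
policies? -/
def NecessarySubset {k : ℕ} (x : SetInstance k) : Prop :=
  ∀ π : List (Fin x.n), IsBalancedPolicy (k * x.n) π → x.items ⊆ bundle x.profile π x.agent

/-! ### Instances as strings

Names of agents and items are binary numerals.  A list of names is written with the symbol `comma`
after each name, and a list of such lists with the symbol `ket` after each list. -/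

open Computability in
/-- A name, in binary. -/
def encName (i : ℕ) : List Γ' :=
  (encodeNat i).map Γ'.bit

open Computability in
/-- A list of names. -/
def encRow (l : List ℕ) : List Γ' :=
  l.flatMap (fun i => encName i ++ [Γ'.comma])

open Computability in
/-- A list of lists of names. -/
def encTable (t : List (List ℕ)) : List Γ' :=
  t.flatMap (fun l => encRow l ++ [Γ'.ket])

/-- The profile as a table: for each agent her name, followed by the items from her most preferred
to her least preferred one. -/
def profileTable {n m : ℕ} (P : Fin n → Equiv.Perm (Fin m)) : List (List ℕ) :=
  List.ofFn (fun a : Fin n => (a : ℕ) :: (prefList (P a)).map Fin.val)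

/-- The string for `(A, I, P, a_j, o)`: the name of `a_j`, the name of `o`, the profile. -/
def encItemInstance {k : ℕ} (x : ItemInstance k) : List Computability.Γ' :=
  encTable ([(x.agent : ℕ)] :: [(x.item : ℕ)] :: profileTable x.profile)

/-- The string for `(A, I, P, a_j, I')`: the name of `a_j`, the names of the elements of `I'` in
increasing order, the profile. -/
def encSetInstance {k : ℕ} (x : SetInstance k) : List Computability.Γ' :=
  encTable ([(x.agent : ℕ)] :: (x.items.sort (· ≤ ·)).map Fin.val :: profileTable x.profile)

/-! Different instances have different strings. -/

theorem flatMap_terminated_injective {α β : Type} (f : α → List β) (s : β)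
    (hf : Function.Injective f) (hs : ∀ a, s ∉ f a) :
    Function.Injective (fun l : List α => l.flatMap (fun a => f a ++ [s])) := by
  have key : ∀ (u v u' v' : List β), s ∉ u → s ∉ v → u ++ s :: u' = v ++ s :: v' →
      u = v ∧ u' = v' := by
    intro u
    induction u with
    | nil =>
      intro v u' v' _ hv h
      cases v with
      | nil => simpa using h
      | cons b v => simp at h; simp [h.1] at hv
    | cons a u ih =>
      intro v u' v' hu hv h
      cases v with
      | nil => simp at h; simp [h.1] at hu
      | cons b v =>
        simp only [List.cons_append, List.cons.injEq] at h
        simp only [List.mem_cons, not_or] at hu hv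
        obtain ⟨h1, h2⟩ := ih v u' v' hu.2 hv.2 h.2
        exact ⟨by rw [h.1, h1], h2⟩
  intro l
  induction l with
  | nil => intro l' h; cases l' <;> simp_all
  | cons a l ih =>
    intro l' h
    cases l' with
    | nil => simp at h
    | cons b l' =>
      simp only [List.flatMap_cons, List.append_assoc, List.singleton_append] at h
      obtain ⟨h1, h2⟩ := key _ _ _ _ (hs a) (hs b) h
      rw [hf h1, ih h2]

theorem encTable_injective : Function.Injective encTable := by
  have hbit : Function.Injective Computability.Γ'.bit := by intro a b h; cases h; rfl
  have hname : Function.Injective encName := fun a b h => by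
    have := List.map_injective_iff.2 hbit h
    rw [← Computability.decode_encodeNat a, this, Computability.decode_encodeNat]
  have hrow : Function.Injective encRow :=
    flatMap_terminated_injective encName _ hname (by simp [encName])
  exact flatMap_terminated_injective encRow _ hrow (by simp [encRow, encName])

theorem profileTable_injective {n m : ℕ} :
    Function.Injective (profileTable : (Fin n → Equiv.Perm (Fin m)) → _) := by
  intro P Q h
  have h1 := List.ofFn_injective h
  funext a
  have h2 := congrFun h1 a
  simp only [List.cons.injEq, true_and] at h2
  have h3 := List.ofFn_injective (List.map_injective_iff.2 Fin.val_injective h2)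
  exact Equiv.coe_fn_injective h3

theorem encItemInstance_injective (k : ℕ) :
    Function.Injective (encItemInstance : ItemInstance k → _) := by
  rintro ⟨⟨n, P, j⟩, o⟩ ⟨⟨n', P', j'⟩, o'⟩ h
  have h := encTable_injective h
  simp only [List.cons.injEq, and_true] at h
  obtain ⟨hj, ho, hP⟩ := h
  have hn : n = n' := by simpa [profileTable] using congrArg List.length hP
  subst hn
  obtain rfl := Fin.ext hj
  obtain rfl := Fin.ext ho
  obtain rfl := profileTable_injective hP
  rfl

theorem encSetInstance_injective (k : ℕ) :
    Function.Injective (encSetInstance : SetInstance k → _) := by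
  rintro ⟨⟨n, P, j⟩, o⟩ ⟨⟨n', P', j'⟩, o'⟩ h
  have h := encTable_injective h
  simp only [List.cons.injEq, and_true] at h
  obtain ⟨hj, ho, hP⟩ := h
  have hn : n = n' := by simpa [profileTable] using congrArg List.length hP
  subst hn
  obtain rfl := Fin.ext hj
  obtain rfl := profileTable_injective hP
  have ho' := congrArg List.toFinset (List.map_injective_iff.2 Fin.val_injective ho)
  simp only [Finset.sort_toFinset] at ho'
  subst ho'
  rfl

/-! ### Polynomial time -/

open Classical in
/-- The decision problem `p`, whose instances `x : α` are given by the strings `enc x` over a finite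
alphabet, is in P: some (multi-tape) Turing machine, started on the string of any instance, halts
with the right answer after a number of steps bounded by a polynomial in the length of the
string. -/
def InP {α Γ : Type} (enc : α → List Γ) (p : α → Prop) : Prop :=
  Nonempty (Turing.TM2ComputableInPolyTime enc Computability.encodeBool (fun x => decide (p x)))

end SeqAlloc

/-! ### A stack language compiled to Turing machines

Data are binary trees, written on a stack in Polish notation. -/

namespace PolyTime

open Turing Computability

/-! Let `U` be the set of items that agent `a` prefers to `o`. If `U` has at least `k` elements, `a`
can be made to spend all her turns on `U` at the start, and she misses `o`. Otherwise a balanced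
policy that denies her `o` can be normalised (`exists_avoids`): `a` takes `U` first, the others keep
their order, and `a` takes her other turns last. The others now choose from fewer items, so `o`,
which one of them took before, is taken by one of them again (`notMem_remaining_filter`). Thus `a`
ends with a set `S` of `k` items that contains `U` but not `o`, and each item outside `S` goes to
another agent who prefers it to all of `S \ U`, with `k` items per agent. This is the certificate
`Avoids`.

Conversely, each certificate yields a policy (`Avoids.exists_policy`), although the agents need not
pick the items given to them. The ordering lemma `exists_order` argues by top trading cycles: each
agent who still owns an item has a favourite that is owned by one of them, so some set of agents is
permuted by "owner of my favourite". These agents take their favourites; each uses one turn and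
loses one owned item, and induction applies.

As `k` is constant, `S` ranges over polynomially many `k`-tuples. For fixed `S`, the items `W`
outside `S` must be matched to `k` slots per agent. An auction decides this: an unassigned item
takes a cheapest slot allowed for it, evicts its owner and raises its price by one. Under Hall's
condition prices never exceed `|W|` (`AuctionInv.exists_cheap`), so `|W| ^ 2` bids suffice
(`matchable_of_hall`).

All this consists of bounded loops over lists. A small stack language is compiled to Turing
machines, and the class `Pol` of functions it computes in polynomial time is closed under
composition, pairing, case distinction and folds with polynomially bounded accumulators
(`Pol.foldl`). The criterion `inP` passes from `Pol` to the machine model. -/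

/-- Binary trees. -/
inductive Bin
  | nil
  | cons (a b : Bin)

/-- The Polish notation of a tree. -/
def Bin.code : Bin → List Bool
  | .nil => [false]
  | .cons a b => true :: (a.code ++ b.code)

/-- The number of symbols in the Polish notation. -/
def Bin.size (t : Bin) : ℕ := t.code.length

@[simp] theorem Bin.size_nil : Bin.nil.size = 1 := rfl

@[simp] theorem Bin.size_cons (a b : Bin) : (Bin.cons a b).size = a.size + b.size + 1 := by
  simp [Bin.size, Bin.code]

/-- The stacks of the machine. -/
inductive Stk
  | inp | data | auxA | auxB | cnt | out
  deriving DecidableEq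

instance : Fintype Stk :=
  ⟨{.inp, .data, .auxA, .auxB, .cnt, .out}, fun k => by cases k <;> simp⟩

/-- The alphabets of the stacks. -/
abbrev Alph : Stk → Type
  | .inp => Γ'
  | .data => Bool
  | .auxA => Bool
  | .auxB => Bool
  | .cnt => Bool
  | .out => Bool

/-- Statements of a machine with labels `Λ`. -/
abbrev St (Λ : Type) := TM2.Stmt Alph Λ (Option Γ')

/-- Configurations of a machine with labels `Λ`. -/
abbrev Conf (Λ : Type) := TM2.Cfg Alph Λ (Option Γ')

/-- The contents of all stacks. -/
def allStk (i : List Γ') (d a b c o : List Bool) : ∀ k, List (Alph k)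
  | .inp => i
  | .data => d
  | .auxA => a
  | .auxB => b
  | .cnt => c
  | .out => o

section contents
variable (i i' : List Γ') (d a b c o x : List Bool)

@[simp] theorem allStk_inp : allStk i d a b c o .inp = i := rfl
@[simp] theorem allStk_data : allStk i d a b c o .data = d := rfl
@[simp] theorem allStk_auxA : allStk i d a b c o .auxA = a := rfl
@[simp] theorem allStk_auxB : allStk i d a b c o .auxB = b := rfl
@[simp] theorem allStk_cnt : allStk i d a b c o .cnt = c := rfl
@[simp] theorem allStk_out : allStk i d a b c o .out = o := rfl

@[simp] theorem update_inp :
    Function.update (allStk i d a b c o) .inp i' = allStk i' d a b c o := by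
  funext k; cases k <;> rfl
@[simp] theorem update_data :
    Function.update (allStk i d a b c o) .data x = allStk i x a b c o := by
  funext k; cases k <;> rfl
@[simp] theorem update_auxA :
    Function.update (allStk i d a b c o) .auxA x = allStk i d x b c o := by
  funext k; cases k <;> rfl
@[simp] theorem update_auxB :
    Function.update (allStk i d a b c o) .auxB x = allStk i d a x c o := by
  funext k; cases k <;> rfl
@[simp] theorem update_cnt :
    Function.update (allStk i d a b c o) .cnt x = allStk i d a b x o := by
  funext k; cases k <;> rfl
@[simp] theorem update_out :
    Function.update (allStk i d a b c o) .out x = allStk i d a b c x := by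
  funext k; cases k <;> rfl
end contents

/-- The bit stored in the internal state. -/
def bitOf : Option Γ' → Bool
  | some (.bit b) => b
  | _ => false

/-- Storing a popped bit in the internal state. -/
def popBit (_ : Option Γ') (x : Option Bool) : Option Γ' := x.map Γ'.bit

/-- Programs acting on the data stack with the help of two auxiliary stacks: `scan x y` moves the
tree on top of the data stack to the auxiliary stack `auxA` (if `x`) and to `auxB` (if `y`), in
reverse; `pourA` and `pourB` move an auxiliary stack back. The test in `ite` and `whl` is whether
the tree on top of the data stack has a left subtree that is not `nil`. -/
inductive Code
  | push (b : Bool)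
  | pop
  | scan (x y : Bool)
  | pourA
  | pourB
  | seq (c d : Code)
  | ite (c d : Code)
  | whl (c : Code)

/-- The labels of a program. -/
def Lab : Code → Type
  | .push _ => Unit
  | .pop => Unit
  | .scan _ _ => Unit
  | .pourA => Unit
  | .pourB => Unit
  | .seq c d => Lab c ⊕ Lab d
  | .ite c d => Option (Lab c ⊕ Lab d)
  | .whl c => Option (Lab c)

/-- There are finitely many labels. -/
noncomputable instance Lab.fintype : (c : Code) → Fintype (Lab c)
  | .push _ => inferInstanceAs (Fintype Unit)
  | .pop => inferInstanceAs (Fintype Unit)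
  | .scan _ _ => inferInstanceAs (Fintype Unit)
  | .pourA => inferInstanceAs (Fintype Unit)
  | .pourB => inferInstanceAs (Fintype Unit)
  | .seq c d =>
    haveI := Lab.fintype c; haveI := Lab.fintype d; inferInstanceAs (Fintype (Lab c ⊕ Lab d))
  | .ite c d =>
    haveI := Lab.fintype c; haveI := Lab.fintype d
    inferInstanceAs (Fintype (Option (Lab c ⊕ Lab d)))
  | .whl c => haveI := Lab.fintype c; inferInstanceAs (Fintype (Option (Lab c)))

/-- The first label of a program. -/
def entry : (c : Code) → Lab c
  | .push _ => ()
  | .pop => ()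
  | .scan _ _ => ()
  | .pourA => ()
  | .pourB => ()
  | .seq c _ => Sum.inl (entry c)
  | .ite _ _ => (none : Option _)
  | .whl _ => (none : Option _)

section statements
variable {Λ : Type}
open TM2.Stmt

/-- Reset the internal state and jump. -/
def jump (l : Λ) : St Λ := load (fun _ => none) (goto fun _ => l)

/-- Jump to `yes` if the tree on top of the data stack has a left subtree that is not `nil`, and to
`no` otherwise. -/
def test (yes no : Λ) : St Λ :=
  pop .data popBit <|
    branch bitOf
      (peek .data popBit <| push .data (fun _ => true) <| branch bitOf (jump yes) (jump no))
      (push .data (fun _ => false) <| jump no)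

/-- Push the stored bit on the stack if `x`. -/
def pushIf (x : Bool) (k : Stk) (h : Alph k = Bool) (q : St Λ) : St Λ :=
  if x then push k (fun v => cast h.symm (bitOf v)) q else q

/-- The statement of a label in a program that is part of a machine; `ex` is the label to jump to
in the end. -/
def stmt : (c : Code) → (Lab c → Λ) → Λ → Lab c → St Λ
  | .push b, _, ex => fun _ => push .data (fun _ => b) (jump ex)
  | .pop, _, ex => fun _ => pop .data popBit (jump ex)
  -- The stack `cnt` counts in unary the trees still to be read after the current one: `true` opens
  -- two subtrees in place of one tree, `false` completes one. A `false` read with `cnt` empty ends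
  -- the scan.
  | .scan x y, emb, ex => fun l =>
    pop .data popBit <| pushIf x .auxA rfl <| pushIf y .auxB rfl <|
      branch bitOf (push .cnt (fun _ => true) <| jump (emb l))
        (pop .cnt popBit <| branch Option.isNone (jump ex) (jump (emb l)))
  | .pourA, emb, ex => fun l =>
    pop .auxA popBit <| branch Option.isNone (jump ex) (push .data bitOf <| jump (emb l))
  | .pourB, emb, ex => fun l =>
    pop .auxB popBit <| branch Option.isNone (jump ex) (push .data bitOf <| jump (emb l))
  | .seq c d, emb, ex =>
    Sum.elim (stmt c (fun l => emb (Sum.inl l)) (emb (Sum.inr (entry d))))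
      (stmt d (fun l => emb (Sum.inr l)) ex)
  | .ite c d, emb, ex => fun l =>
    Option.elim (α := Lab c ⊕ Lab d) l
      (test (emb (some (Sum.inl (entry c)) : Option _)) (emb (some (Sum.inr (entry d)) : Option _)))
      (Sum.elim (stmt c (fun l => emb (some (Sum.inl l) : Option _)) ex)
        (stmt d (fun l => emb (some (Sum.inr l) : Option _)) ex))
  | .whl c, emb, ex => fun l =>
    Option.elim (α := Lab c) l
      (test (emb (some (entry c) : Option _)) ex)
      (stmt c (fun l => emb (some l : Option _)) (emb (none : Option _)))

end statements

/-- The machine gets from `x` to `y` in at most `n` steps. -/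
def Reach {Λ : Type} (M : Λ → St Λ) (n : ℕ) (x y : Conf Λ) : Prop :=
  ∃ k ≤ n, (flip bind (TM2.step M))^[k] (some x) = some y

section reach
variable {Λ : Type} {M : Λ → St Λ}

theorem Reach.trans {n m : ℕ} {x y z : Conf Λ} (h : Reach M n x y) (h' : Reach M m y z) :
    Reach M (n + m) x z := by
  obtain ⟨k, hk, e⟩ := h
  obtain ⟨k', hk', e'⟩ := h'
  exact ⟨k' + k, by omega, by rw [Function.iterate_add_apply, e, e']⟩

theorem Reach.mono {n m : ℕ} {x y : Conf Λ} (h : Reach M n x y) (hnm : n ≤ m) : Reach M m x y := by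
  obtain ⟨k, hk, e⟩ := h
  exact ⟨k, hk.trans hnm, e⟩

theorem Reach.single {x y : Conf Λ} (h : TM2.step M x = some y) : Reach M 1 x y := ⟨1, le_rfl, h⟩

theorem Reach.head {n : ℕ} {x y z : Conf Λ} (h : TM2.step M x = some y) (h' : Reach M n y z) :
    Reach M (n + 1) x z := by
  rw [add_comm]; exact (Reach.single h).trans h'

end reach

/-- The configuration with given data and auxiliary stacks. -/
def conf {Λ : Type} (l : Λ) (d a b c : List Bool) : Conf Λ :=
  ⟨some l, none, allStk [] d a b c []⟩

/-- The program `c` turns the data stack and the auxiliary stacks `s` into `s'` in at most `n`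
steps, inside any machine. -/
def Does (c : Code) (s s' : List Bool × List Bool × List Bool) (n : ℕ) : Prop :=
  ∀ (Λ : Type) (M : Λ → St Λ) (emb : Lab c → Λ) (ex : Λ), (∀ l, M (emb l) = stmt c emb ex l) →
    Reach M n (conf (emb (entry c)) s.1 s.2.1 s.2.2 []) (conf ex s'.1 s'.2.1 s'.2.2 [])

theorem Does.mono {c : Code} {s s' : List Bool × List Bool × List Bool} {n m : ℕ}
    (h : Does c s s' n) (hnm : n ≤ m) : Does c s s' m :=
  fun Λ M emb ex hM => (h Λ M emb ex hM).mono hnm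

theorem Does.push (b : Bool) (d x y : List Bool) : Does (.push b) (d, x, y) (b :: d, x, y) 1 := by
  intro Λ M emb ex hM
  apply Reach.single
  simp [conf, hM, stmt, jump]

theorem Does.pop (b : Bool) (d x y : List Bool) : Does .pop (b :: d, x, y) (d, x, y) 1 := by
  intro Λ M emb ex hM
  apply Reach.single
  simp [conf, hM, stmt, jump]

theorem Does.seq {c d : Code} {s t u : List Bool × List Bool × List Bool} {n m : ℕ}
    (h : Does c s t n) (h' : Does d t u m) : Does (.seq c d) s u (n + m) := by
  intro Λ M emb ex hM
  exact (h Λ M (fun l => emb (Sum.inl l)) (emb (Sum.inr (entry d))) fun l => hM (Sum.inl l)).trans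
    (h' Λ M (fun l => emb (Sum.inr l)) ex fun l => hM (Sum.inr l))

theorem test_true {Λ : Type} {M : Λ → St Λ} {l yes no : Λ} (h : M l = test yes no)
    (d a b c : List Bool) :
    TM2.step M (conf l (true :: true :: d) a b c) = some (conf yes (true :: true :: d) a b c) := by
  simp [conf, h, test, jump, popBit, bitOf]

theorem test_true_false {Λ : Type} {M : Λ → St Λ} {l yes no : Λ} (h : M l = test yes no)
    (d a b c : List Bool) :
    TM2.step M (conf l (true :: false :: d) a b c) = some (conf no (true :: false :: d) a b c) := by
  simp [conf, h, test, jump, popBit, bitOf]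

theorem Does.ite_true {c d : Code} {l x y : List Bool} {u : List Bool × List Bool × List Bool}
    {n : ℕ} (h : Does c (true :: true :: l, x, y) u n) :
    Does (.ite c d) (true :: true :: l, x, y) u (n + 1) := by
  intro Λ M emb ex hM
  exact Reach.head (test_true (hM (none : Option _)) _ _ _ _)
    (h Λ M (fun l => emb (some (Sum.inl l) : Option _)) ex
      fun l => hM (some (Sum.inl l) : Option _))

theorem Does.ite_false {c d : Code} {l x y : List Bool} {u : List Bool × List Bool × List Bool}
    {n : ℕ} (h : Does d (true :: false :: l, x, y) u n) :
    Does (.ite c d) (true :: false :: l, x, y) u (n + 1) := by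
  intro Λ M emb ex hM
  exact Reach.head (test_true_false (hM (none : Option _)) _ _ _ _)
    (h Λ M (fun l => emb (some (Sum.inr l) : Option _)) ex
      fun l => hM (some (Sum.inr l) : Option _))

theorem Does.whl_true {c : Code} {l x y : List Bool} {t u : List Bool × List Bool × List Bool}
    {n m : ℕ} (h : Does c (true :: true :: l, x, y) t n) (h' : Does (.whl c) t u m) :
    Does (.whl c) (true :: true :: l, x, y) u (n + m + 1) := by
  intro Λ M emb ex hM
  exact Reach.head (test_true (hM (none : Option _)) _ _ _ _)
    ((h Λ M (fun l => emb (some l : Option _)) (emb (none : Option _))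
      fun l => hM (some l : Option _)).trans (h' Λ M emb ex hM))

theorem Does.whl_false {c : Code} {l x y : List Bool} :
    Does (.whl c) (true :: false :: l, x, y) (true :: false :: l, x, y) 1 := by
  intro Λ M emb ex hM
  exact Reach.single (test_true_false (hM (none : Option _)) _ _ _ _)

theorem Does.pourA (d x y : List Bool) :
    Does .pourA (d, x, y) (x.reverse ++ d, [], y) (x.length + 1) := by
  intro Λ M emb ex hM
  have e := hM ()
  induction x generalizing d with
  | nil =>
    apply Reach.single
    simp [conf, e, stmt, jump, popBit, entry]
  | cons b x ih =>
    have := ih (b :: d)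
    simp only [List.reverse_cons, List.append_assoc, List.singleton_append]
    refine Reach.head ?_ this
    simp [conf, e, stmt, jump, popBit, bitOf, entry]

theorem Does.pourB (d x y : List Bool) :
    Does .pourB (d, x, y) (y.reverse ++ d, x, []) (y.length + 1) := by
  intro Λ M emb ex hM
  have e := hM ()
  induction y generalizing d with
  | nil =>
    apply Reach.single
    simp [conf, e, stmt, jump, popBit, entry]
  | cons b x ih =>
    have := ih (b :: d)
    simp only [List.reverse_cons, List.append_assoc, List.singleton_append]
    refine Reach.head ?_ this
    simp [conf, e, stmt, jump, popBit, bitOf, entry]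

/-- `l` if `x`, and nothing otherwise. -/
def keep (x : Bool) (l : List Bool) : List Bool := if x then l else []

theorem scan_step {Λ : Type} {M : Λ → St Λ} {x y : Bool} {emb : Lab (.scan x y) → Λ} {ex : Λ}
    (hM : ∀ l, M (emb l) = stmt (.scan x y) emb ex l) (v : Bool) (d a b c : List Bool) :
    TM2.step M (conf (emb ()) (v :: d) a b c) =
      some (conf (if v = false ∧ c = [] then ex else emb ()) d (keep x [v] ++ a) (keep y [v] ++ b)
        (if v then true :: c else c.tail)) := by
  have e := hM ()
  cases x <;> cases y <;> cases v <;> cases c <;>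
    simp [conf, e, stmt, jump, popBit, bitOf, pushIf, keep]

/-- The counter is generalised for the induction: reading a complete tree costs one pending mark,
and the loop is left exactly when there was none. -/
theorem scan_reach {Λ : Type} {M : Λ → St Λ} {x y : Bool} {emb : Lab (.scan x y) → Λ} {ex : Λ}
    (hM : ∀ l, M (emb l) = stmt (.scan x y) emb ex l) (t : Bin) (d a b c : List Bool) :
    Reach M t.size (conf (emb ()) (t.code ++ d) a b c)
      (conf (if c = [] then ex else emb ()) d (keep x t.code.reverse ++ a)
        (keep y t.code.reverse ++ b) c.tail) := by
  induction t generalizing d a b c with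
  | nil =>
    apply Reach.single
    simp [Bin.code, scan_step hM]
  | cons t u iht ihu =>
    rw [Bin.size_cons]
    have h1 := scan_step hM true (t.code ++ (u.code ++ d)) a b c
    have h2 := iht (u.code ++ d) (keep x [true] ++ a) (keep y [true] ++ b) (true :: c)
    have h3 := ihu d (keep x t.code.reverse ++ (keep x [true] ++ a))
      (keep y t.code.reverse ++ (keep y [true] ++ b)) c
    simp only [Bool.true_eq_false, false_and, if_false, if_true] at h1
    simp only [reduceCtorEq, if_false, List.tail_cons] at h2
    have h4 := Reach.head h1 (h2.trans h3)
    have hk : ∀ z : Bool, ∀ e : List Bool, keep z (Bin.cons t u).code.reverse ++ e =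
        keep z u.code.reverse ++ (keep z t.code.reverse ++ (keep z [true] ++ e)) := by
      intro z e; cases z <;> simp [keep, Bin.code]
    rw [hk, hk]
    simpa [Bin.code] using h4

theorem Does.scan (x y : Bool) (t : Bin) (d a b : List Bool) :
    Does (.scan x y) (t.code ++ d, a, b)
      (d, keep x t.code.reverse ++ a, keep y t.code.reverse ++ b) t.size := by
  intro Λ M emb ex hM
  have := scan_reach hM t d a b []
  rw [if_pos rfl] at this
  exact this

namespace Code

/-- Delete the top tree. -/
def drop : Code := .scan false false

/-- Duplicate the top tree. -/
def dup : Code := .seq (.scan true true) (.seq .pourA .pourB)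

/-- Exchange the two top trees. -/
def swap : Code := .seq (.scan true false) (.seq (.scan false true) (.seq .pourA .pourB))

end Code

theorem Does.drop (t : Bin) (d : List Bool) : Does .drop (t.code ++ d, [], []) (d, [], []) t.size :=
  Does.scan false false t d [] []

theorem Does.dup (t : Bin) (d : List Bool) :
    Does .dup (t.code ++ d, [], []) (t.code ++ (t.code ++ d), [], []) (3 * t.size + 2) := by
  have := (Does.scan true true t d [] []).seq
    ((Does.pourA _ _ _).seq (Does.pourB _ _ _))
  simp only [keep, if_true, List.append_nil, List.reverse_reverse, List.length_reverse] at this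
  exact this.mono (by simp only [Bin.size]; omega)

/-- Both trees are parked, `t` on `auxA` and `u` on `auxB`; pouring `auxA` back first puts `t` below
`u`. -/
theorem Does.swap (t u : Bin) (d : List Bool) :
    Does .swap (t.code ++ (u.code ++ d), [], []) (u.code ++ (t.code ++ d), [], [])
      (2 * t.size + 2 * u.size + 2) := by
  have := (Does.scan true false t (u.code ++ d) [] []).seq ((Does.scan false true u d _ _).seq
    ((Does.pourA _ _ _).seq (Does.pourB _ _ _)))
  simp only [keep, if_true, List.append_nil, List.reverse_reverse, List.length_reverse,
    List.nil_append, Bool.false_eq_true, if_false] at this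
  exact this.mono (by simp only [Bin.size]; omega)

end PolyTime

/-! ### Functions computable in polynomial time -/

namespace PolyTime

open Turing Computability

/-- Coefficients in `ℕ` make every time bound monotone, so that size estimates can be substituted
into it. -/
theorem eval_mono (P : Polynomial ℕ) {a b : ℕ} (h : a ≤ b) : P.eval a ≤ P.eval b := by
  rw [Polynomial.eval_eq_sum, Polynomial.eval_eq_sum]
  exact Finset.sum_le_sum fun i _ => Nat.mul_le_mul_left _ (Nat.pow_le_pow_left h i)

/-- Data represented by trees. -/
class Enc (α : Type) where
  /-- the tree that represents an element -/
  enc : α → Bin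

open Enc (enc)

/-- The size of the representation. -/
def sz {α : Type} [Enc α] (x : α) : ℕ := (Enc.enc x).size

instance : Enc Unit := ⟨fun _ => .nil⟩
-- `true` has the tree of `[()]` and `false` that of `[]`, so branching on a boolean is a case
-- distinction on a list.
instance : Enc Bool := ⟨fun b => if b then .cons .nil .nil else .nil⟩

section instances
variable {α β : Type} [Enc α] [Enc β]

instance : Enc (α × β) := ⟨fun x => .cons (Enc.enc x.1) (Enc.enc x.2)⟩

/-- The representation of a list. -/
def encList : List α → Bin
  | [] => .nil
  | a :: l => .cons (Enc.enc a) (encList l)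

instance : Enc (List α) := ⟨encList⟩

/-- A number shares its tree with its list of binary digits, so passing between the two costs
nothing. -/
instance : Enc ℕ := ⟨fun n => Enc.enc (encodeNat n)⟩

@[simp] theorem sz_pair (x : α) (y : β) : sz (x, y) = sz x + sz y + 1 := Bin.size_cons _ _
@[simp] theorem sz_nil : sz ([] : List α) = 1 := rfl
@[simp] theorem sz_cons (a : α) (l : List α) : sz (a :: l) = sz a + sz l + 1 := Bin.size_cons _ _

@[simp] theorem sz_append (l l' : List α) : sz (l ++ l') + 1 = sz l + sz l' := by
  induction l with
  | nil => simp; omega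
  | cons a l ih => simp only [List.cons_append, sz_cons]; omega

theorem length_lt_sz (l : List α) : l.length < sz l := by
  induction l with
  | nil => simp
  | cons a l ih => simp only [List.length_cons, sz_cons]; omega

theorem sz_lt_of_mem {a : α} {l : List α} (h : a ∈ l) : sz a < sz l := by
  induction l with
  | nil => simp at h
  | cons b l ih =>
    rcases List.mem_cons.1 h with rfl | h
    · simp only [sz_cons]; omega
    · have := ih h; simp only [sz_cons]; omega

theorem sz_le_of_sublist {l l' : List α} (h : l.Sublist l') : sz l ≤ sz l' := by
  induction h with
  | slnil => exact le_rfl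
  | cons a _ ih => simp only [sz_cons]; omega
  | cons_cons a _ ih => simp only [sz_cons]; omega

theorem sz_le_length_mul {l : List α} {N : ℕ} (h : ∀ a ∈ l, sz a ≤ N) :
    sz l ≤ l.length * (N + 1) + 1 := by
  induction l with
  | nil => simp
  | cons a l ih =>
    have h1 := h a (by simp)
    have h2 := ih fun b hb => h b (by simp [hb])
    simp only [sz_cons, List.length_cons, Nat.succ_mul]
    omega

@[simp] theorem sz_reverse (l : List α) : sz l.reverse = sz l := by
  induction l with
  | nil => rfl
  | cons a l ih =>
    have := sz_append l.reverse [a]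
    simp only [sz_cons, sz_nil] at this
    simp only [List.reverse_cons, sz_cons]
    omega

theorem sz_bool (b : Bool) : sz b ≤ 3 := by cases b <;> decide

end instances

/-- The program replaces the tree `t` on top of the data stack by `u` in at most `n` steps. -/
def Runs (c : Code) (t u : Bin) (n : ℕ) : Prop :=
  ∀ d, Does c (t.code ++ d, [], []) (u.code ++ d, [], []) n

/-- The function is computed by a program in polynomial time. -/
def Pol {α β : Type} [Enc α] [Enc β] (f : α → β) : Prop :=
  ∃ (c : Code) (P : Polynomial ℕ), ∀ x,
    Runs c (enc x) (enc (f x)) (P.eval (sz x)) ∧ sz (f x) ≤ P.eval (sz x)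

theorem Runs.mono {c : Code} {t u : Bin} {n m : ℕ} (h : Runs c t u n) (hnm : n ≤ m) :
    Runs c t u m := fun d => (h d).mono hnm

theorem Runs.seq {c c' : Code} {t u v : Bin} {n m : ℕ} (h : Runs c t u n) (h' : Runs c' u v m) :
    Runs (.seq c c') t v (n + m) := fun d => (h d).seq (h' d)

variable {α β γ δ ε : Type} [Enc α] [Enc β] [Enc γ] [Enc δ] [Enc ε]

namespace Pol

theorem of_eq {f g : α → β} (hf : Pol f) (h : ∀ x, f x = g x) : Pol g := by
  rwa [← funext h]

/-- The bound on the output size, kept alongside the time bound in `Pol`, is what makes the running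
time of the second program polynomial in the first input. -/
theorem comp {g : β → γ} {f : α → β} (hg : Pol g) (hf : Pol f) : Pol fun x => g (f x) := by
  obtain ⟨c, P, h⟩ := hf
  obtain ⟨c', Q, h'⟩ := hg
  refine ⟨.seq c c', P + Q.comp P, fun x => ⟨?_, ?_⟩⟩
  · refine ((h x).1.seq (h' (f x)).1).mono ?_
    simpa using eval_mono Q (h x).2
  · have := (h' (f x)).2.trans (eval_mono Q (h x).2)
    simp only [Polynomial.eval_add, Polynomial.eval_comp]
    omega

/-- The program that pushes bits. -/
def pushAll : List Bool → Code
  -- A program without effect; the language has no empty program.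
  | [] => .seq (.push true) .pop
  | b :: l => .seq (pushAll l) (.push b)

theorem does_pushAll (l d : List Bool) :
    Does (pushAll l) (d, [], []) (l ++ d, [], []) (l.length + 2) := by
  induction l with
  | nil => exact (Does.push _ _ _ _).seq (Does.pop _ _ _ _)
  | cons b l ih => exact (ih.seq (Does.push _ _ _ _)).mono (by simp)

theorem const (b : β) : Pol fun _ : α => b := by
  refine ⟨.seq .drop (pushAll (enc b).code), Polynomial.X + Polynomial.C (sz b + 2),
    fun x => ⟨fun d => ?_, by simp only [Polynomial.eval_add, Polynomial.eval_X, Polynomial.eval_C]; omega⟩⟩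
  refine ((Does.drop _ _).seq (does_pushAll _ _)).mono ?_
  simp [sz, Bin.size]

theorem id : Pol fun x : α => x := by
  refine ⟨.seq (.push true) .pop, Polynomial.X + 2, fun x => ⟨fun d => ?_, by simp⟩⟩
  exact ((Does.push _ _ _ _).seq (Does.pop _ _ _ _)).mono (by simp)

/-- The code of a pair is `true` followed by the codes of its components, so one `pop` leaves the
components as two separate trees on the stack. -/
theorem fst : Pol fun x : α × β => x.1 := by
  refine ⟨.seq .pop (.seq .swap .drop), 3 * Polynomial.X + 3,
    fun ⟨x, y⟩ => ⟨fun d => ?_, by simp; omega⟩⟩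
  have := (Does.pop true ((enc x).code ++ ((enc y).code ++ d)) [] []).seq
    ((Does.swap (enc x) (enc y) d).seq (Does.drop (enc y) _))
  simp only [enc, Bin.code, List.cons_append, List.append_assoc]
  refine this.mono ?_
  simp
  simp only [sz]
  omega

theorem snd : Pol fun x : α × β => x.2 := by
  refine ⟨.seq .pop .drop, Polynomial.X + 1,
    fun ⟨x, y⟩ => ⟨fun d => ?_, by simp; omega⟩⟩
  have := (Does.pop true ((enc x).code ++ ((enc y).code ++ d)) [] []).seq
    (Does.drop (enc x) _)
  simp only [enc, Bin.code, List.cons_append, List.append_assoc]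
  refine this.mono ?_
  simp
  simp only [sz]
  omega

/-- Programs work above arbitrary stack contents, so `f` can run on a copy of `x` while `x` waits
below for `g`. The last swap and the pushed `true` assemble the pair. -/
theorem pair {f : α → β} {g : α → γ} (hf : Pol f) (hg : Pol g) : Pol fun x => (f x, g x) := by
  obtain ⟨c, P, h⟩ := hf
  obtain ⟨c', Q, h'⟩ := hg
  refine ⟨.seq .dup (.seq c (.seq .swap (.seq c' (.seq .swap (.push true))))),
    7 * Polynomial.X + 5 * P + 5 * Q + 10, fun x => ⟨fun d => ?_, ?_⟩⟩
  · have := (Does.dup (enc x) d).seq (((h x).1 _).seq ((Does.swap (enc (f x)) (enc x) d).seq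
      (((h' x).1 _).seq ((Does.swap (enc (g x)) (enc (f x)) d).seq (Does.push true _ _ _)))))
    have e : (enc (f x, g x)).code ++ d = true :: ((enc (f x)).code ++ ((enc (g x)).code ++ d)) := by
      simp [enc, Bin.code]
    rw [e]
    refine this.mono ?_
    have h1 := (h x).2
    have h2 := (h' x).2
    simp only [sz, Polynomial.eval_add, Polynomial.eval_mul, Polynomial.eval_X,
      Polynomial.eval_ofNat] at *
    omega
  · have h1 := (h x).2
    have h2 := (h' x).2
    simp only [sz_pair, Polynomial.eval_add, Polynomial.eval_mul, Polynomial.eval_X,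
      Polynomial.eval_ofNat]
    omega

theorem comp₂ {f : β → γ → δ} {g : α → β} {h : α → γ} (hf : Pol fun p : β × γ => f p.1 p.2)
    (hg : Pol g) (hh : Pol h) : Pol fun x => f (g x) (h x) :=
  comp (g := fun p : β × γ => f p.1 p.2) (f := fun x => (g x, h x)) hf (hg.pair hh)

/-- The test of `ite` on the tree of `(l x, x)` asks whether `l x` is nonempty. In that case this
tree is literally the tree of `((b, t), x)`, and `g` can start at once. -/
theorem listCases {l : α → List β} {f : α → γ} {g : (β × List β) × α → γ} (hl : Pol l)
    (hf : Pol f) (hg : Pol g) :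
    Pol fun x => (match l x with | [] => f x | b :: t => g ((b, t), x) : γ) := by
  obtain ⟨c, P, h⟩ := hl.pair id
  obtain ⟨c', Q, h'⟩ := hf.comp (snd (α := List β) (β := α))
  obtain ⟨c'', R, h''⟩ := hg
  refine ⟨.seq c (.ite c'' c'), P + Q.comp P + R.comp P + 1, fun x => ⟨fun d => ?_, ?_⟩⟩
  · have h1 := h x
    have h2 := h' (l x, x)
    rcases hlx : l x with _ | ⟨b, t⟩
    · simp only [hlx] at h1 h2 ⊢
      have h3 := h2.1 d
      have e : (enc (([] : List β), x)).code ++ d = true :: false :: ((enc x).code ++ d) := rfl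
      rw [e] at h3
      refine ((h1.1 d).seq h3.ite_false).mono ?_
      have := eval_mono Q h1.2
      simp only [Polynomial.eval_add, Polynomial.eval_comp, Polynomial.eval_one]
      omega
    · simp only [hlx] at h1 ⊢
      have h3 := (h'' ((b, t), x)).1 d
      have e : (enc ((b, t), x)).code ++ d =
          true :: true :: (((enc b).code ++ (enc t).code ++ (enc x).code) ++ d) := by
        simp [enc, Bin.code]
      rw [e] at h3
      have e' : (enc (b :: t, x)).code ++ d =
          true :: true :: (((enc b).code ++ (enc t).code ++ (enc x).code) ++ d) := by
        rw [← e]; rfl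
      have h4 := h1.1 d
      rw [e'] at h4
      refine (h4.seq h3.ite_true).mono ?_
      have := eval_mono R h1.2
      have e2 : sz ((b, t), x) = sz (b :: t, x) := rfl
      rw [e2]
      simp only [Polynomial.eval_add, Polynomial.eval_comp, Polynomial.eval_one]
      omega
  · have h1 := h x
    have h2 := h' (l x, x)
    simp only [Polynomial.eval_add, Polynomial.eval_comp, Polynomial.eval_one]
    rcases hlx : l x with _ | ⟨b, t⟩
    · simp only [hlx] at h1 h2 ⊢
      have := h2.2.trans (eval_mono Q h1.2)
      omega
    · simp only [hlx] at h1 ⊢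
      have := (h'' ((b, t), x)).2.trans (eval_mono R h1.2)
      omega

/-- The steps of a loop over a list. -/
theorem runs_whl {c : Code} {P : Polynomial ℕ} {f : ε → γ → β → γ}
    (h : ∀ b t e a, Runs c (enc ((b :: t : List β), (e, a))) (enc (t, (e, f e a b)))
      (P.eval (sz (b :: t, (e, a))))) (e : ε) (K N : ℕ) (l : List β) (a : γ) (hN : sz l ≤ N)
    (hK : ∀ l', l' <+: l → sz (l'.foldl (f e) a) ≤ K) :
    Runs (.whl c) (enc (l, (e, a))) (enc (([] : List β), (e, l.foldl (f e) a)))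
      (l.length * (P.eval (N + sz e + K + 2) + 1) + 1) := by
  induction l generalizing a with
  | nil =>
    intro d
    exact (Does.whl_false).mono (by simp)
  | cons b t ih =>
    intro d
    have h1 := h b t e a d
    have e1 : (enc ((b :: t : List β), (e, a))).code ++ d =
        true :: true :: (((enc b).code ++ (enc t).code ++ (enc (e, a)).code) ++ d) := by
      simp [enc, encList, Bin.code]
    have h2 := ih (f e a b) (by simp only [sz_cons] at hN; omega)
      (fun l' hl' => hK (b :: l') (by simpa using hl')) d
    rw [e1] at h1 ⊢
    refine (h1.whl_true h2).mono ?_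
    -- The empty prefix in `hK` bounds the present accumulator; `2` counts the two pair nodes.
    have h3 : sz (b :: t, (e, a)) ≤ N + sz e + K + 2 := by
      have := hK [] (by simp)
      simp only [List.foldl_nil] at this
      simp only [sz_pair]
      omega
    have := eval_mono P h3
    simp only [List.length_cons, Nat.succ_mul]
    omega

/-- Iterating a polynomial-time step can make data grow exponentially. The hypothesis `hQ` excludes
this by bounding the accumulator after every prefix, so all passes of the loop share one time bound.
-/
theorem foldl {l : α → List β} {i : α → γ} {f : α → γ → β → γ} (hl : Pol l) (hi : Pol i)
    (hf : Pol fun p : α × γ × β => f p.1 p.2.1 p.2.2) (Q : Polynomial ℕ)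
    (hQ : ∀ x l', l' <+: l x → sz (l'.foldl (f x) (i x)) ≤ Q.eval (sz x)) :
    Pol fun x => (l x).foldl (f x) (i x) := by
  obtain ⟨cl, Pl, hl⟩ := hl.pair (id.pair hi)
  have hbody : Pol fun p : (β × List β) × (α × γ) => (p.1.2, (p.2.1, f p.2.1 p.2.2 p.1.1)) :=
    (snd.comp fst).pair ((fst.comp snd).pair
      (hf.comp ((fst.comp snd).pair ((snd.comp snd).pair (fst.comp fst)))))
  obtain ⟨cb, Pb, hb⟩ := hbody
  obtain ⟨cs, Ps, hs⟩ := (snd (α := α) (β := γ)).comp (snd (α := List β) (β := α × γ))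
  refine ⟨.seq cl (.seq (.whl cb) cs),
    Pl + (Pl * (Pb.comp (Pl + Polynomial.X + Q + 2) + 1) + 1) +
      Ps.comp (Polynomial.X + Q + 3) + Q, fun x => ⟨?_, ?_⟩⟩
  · have h1 := hl x
    have h2 := runs_whl (c := cb) (P := Pb) (f := f) (fun b t e a => (hb ((b, t), (e, a))).1) x
      (Q.eval (sz x)) (Pl.eval (sz x)) (l x) (i x)
      (by have := h1.2; simp only [sz_pair] at this; omega) (hQ x)
    have h3 := hs ([], x, (l x).foldl (f x) (i x))
    refine (h1.1.seq (h2.seq h3.1)).mono ?_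
    have h4 : sz (([] : List β), x, (l x).foldl (f x) (i x)) ≤ sz x + Q.eval (sz x) + 3 := by
      have := hQ x _ List.prefix_rfl
      simp only [sz_pair, sz_nil]
      omega
    have h5 := eval_mono Ps h4
    have h6 : (l x).length ≤ Pl.eval (sz x) := by
      have h7 := h1.2
      have h8 := length_lt_sz (l x)
      simp only [sz_pair] at h7
      omega
    have h9 := Nat.mul_le_mul_right (Pb.eval (Pl.eval (sz x) + sz x + Q.eval (sz x) + 2) + 1) h6
    simp only [Polynomial.eval_add, Polynomial.eval_comp, Polynomial.eval_mul, Polynomial.eval_X,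
      Polynomial.eval_one, Polynomial.eval_ofNat]
    omega
  · have := hQ x _ List.prefix_rfl
    simp only [Polynomial.eval_add]
    omega

end Pol

end PolyTime

/-! ### Polynomial-time operations on booleans, lists and numerals -/

namespace PolyTime

open Turing Computability
open Enc (enc)

variable {α β γ δ ε : Type} [Enc α] [Enc β] [Enc γ] [Enc δ] [Enc ε]

namespace Pol

/-- A function that leaves the tree unchanged is computed by the program for the identity. -/
theorem of_enc_eq {f : α → β} (h : ∀ x, Enc.enc (f x) = Enc.enc x) : Pol f := by
  obtain ⟨c, P, hc⟩ := id (α := α)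
  refine ⟨c, P, fun x => ?_⟩
  have := hc x
  unfold sz at *
  rw [h]
  exact this

theorem cons {f : α → β} {l : α → List β} (hf : Pol f) (hl : Pol l) : Pol fun x => f x :: l x :=
  (of_enc_eq (f := fun p : β × List β => p.1 :: p.2) fun _ => rfl).comp (hf.pair hl)

theorem cond {c : α → Bool} {f g : α → β} (hc : Pol c) (hf : Pol f) (hg : Pol g) :
    Pol fun x => bif c x then f x else g x := by
  have h1 : Pol fun b : Bool => if b then [()] else [] :=
    of_enc_eq fun b => by cases b <;> rfl
  refine (listCases (h1.comp hc) hg (hf.comp (snd (α := Unit × List Unit)))).of_eq fun x => ?_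
  cases c x <;> rfl

theorem not {c : α → Bool} (hc : Pol c) : Pol fun x => !c x :=
  (hc.cond (const false) (const true)).of_eq fun x => by cases c x <;> rfl

theorem and {c d : α → Bool} (hc : Pol c) (hd : Pol d) : Pol fun x => c x && d x :=
  (hc.cond hd (const false)).of_eq fun x => by cases c x <;> rfl

theorem or {c d : α → Bool} (hc : Pol c) (hd : Pol d) : Pol fun x => c x || d x :=
  (hc.cond (const true) hd).of_eq fun x => by cases c x <;> rfl

theorem headD {l : α → List β} {b : α → β} (hl : Pol l) (hb : Pol b) :
    Pol fun x => (l x).headD (b x) :=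
  (listCases hl hb (fst.comp (fst (β := α)))).of_eq fun x => by cases l x <;> rfl

theorem tail {l : α → List β} (hl : Pol l) : Pol fun x => (l x).tail :=
  (listCases hl (const []) (snd.comp (fst (β := α)))).of_eq fun x => by cases l x <;> rfl

/-- Here `k` is fixed, so the program may depend on it and simply repeats `cons`. -/
theorem replicate (k : ℕ) {f : α → β} (hf : Pol f) : Pol fun x => List.replicate k (f x) := by
  induction k with
  | zero => exact const []
  | succ k ih => exact hf.cons ih

theorem foldl_flip_cons {β : Type} (l acc : List β) :
    l.foldl (fun a b => b :: a) acc = l.reverse ++ acc := by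
  induction l generalizing acc with
  | nil => rfl
  | cons b l ih => simp [ih]

theorem reverse {l : α → List β} (hl : Pol l) : Pol fun x => (l x).reverse := by
  have h : Pol fun l : List β => l.foldl (fun a b => b :: a) [] := by
    refine foldl (f := fun _ a b => b :: a) id (const [])
      ((snd.comp snd).cons (fst.comp snd)) Polynomial.X fun l l' hl' => ?_
    rw [foldl_flip_cons, List.append_nil, sz_reverse, Polynomial.eval_X]
    exact sz_le_of_sublist hl'.sublist
  exact (h.comp hl).of_eq fun x => by simp

theorem append {l m : α → List β} (hl : Pol l) (hm : Pol m) : Pol fun x => l x ++ m x := by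
  have h : Pol fun p : List β × List β => p.1.foldl (fun a b => b :: a) p.2 := by
    refine foldl (f := fun _ a b => b :: a) fst snd
      ((snd.comp snd).cons (fst.comp snd)) Polynomial.X fun p l' hl' => ?_
    have h1 := sz_append l'.reverse p.2
    have h2 := sz_le_of_sublist hl'.sublist
    rw [sz_reverse] at h1
    rw [foldl_flip_cons, Polynomial.eval_X]
    have h3 : sz p = sz p.1 + sz p.2 + 1 := sz_pair p.1 p.2
    omega
  exact (h.comp (hl.reverse.pair hm)).of_eq fun x => by simp

theorem foldl_append {β γ : Type} (f : β → List γ) (l : List β) (acc : List γ) :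
    l.foldl (fun a b => a ++ f b) acc = acc ++ l.flatMap f := by
  induction l generalizing acc with
  | nil => simp
  | cons b l ih => simp [ih]

theorem sz_flatMap_le {β : Type} {f : β → List γ} {l : List β} {N : ℕ} (h : ∀ b ∈ l, sz (f b) ≤ N) :
    sz (l.flatMap f) ≤ l.length * N + 1 := by
  induction l with
  | nil => simp
  | cons b l ih =>
    have h1 := h b (by simp)
    have h2 := ih fun c hc => h c (by simp [hc])
    have h3 := sz_append (f b) (l.flatMap f)
    simp only [List.flatMap_cons, List.length_cons, Nat.succ_mul]
    omega

theorem flatMap {l : α → List β} {f : α → β → List γ} (hl : Pol l)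
    (hf : Pol fun p : α × β => f p.1 p.2) : Pol fun x => (l x).flatMap (f x) := by
  obtain ⟨_, P, hP⟩ := _root_.id hf
  obtain ⟨_, R, hR⟩ := _root_.id hl
  refine (foldl (f := fun x a b => a ++ f x b) hl (const [])
    ((fst.comp snd).append (hf.comp (fst.pair (snd.comp snd))))
    -- At most `R` pieces are concatenated, each computed from a pair of size at most `X + R + 1`.
    (R * P.comp (Polynomial.X + R + 1) + 1) fun x l' hl' => ?_).of_eq fun x => ?_
  · have h1 : ∀ b ∈ l', sz (f x b) ≤ P.eval (sz x + R.eval (sz x) + 1) := fun b hb =>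
      (hP (x, b)).2.trans (eval_mono P (by
        have h2 := sz_lt_of_mem (hl'.subset hb)
        have h3 := (hR x).2
        simp only [sz_pair]
        omega))
    rw [foldl_append, List.nil_append]
    refine (sz_flatMap_le h1).trans ?_
    have h4 : l'.length ≤ R.eval (sz x) :=
      hl'.length_le.trans ((length_lt_sz _).le.trans (hR x).2)
    simp only [Polynomial.eval_add, Polynomial.eval_comp, Polynomial.eval_mul, Polynomial.eval_X,
      Polynomial.eval_one]
    gcongr
  · rw [foldl_append, List.nil_append]

theorem map {l : α → List β} {f : α → β → γ} (hl : Pol l)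
    (hf : Pol fun p : α × β => f p.1 p.2) : Pol fun x => (l x).map (f x) :=
  (flatMap hl (f := fun x b => [f x b]) (hf.cons (const []))).of_eq fun x => by
    induction l x with
    | nil => rfl
    | cons b l ih => simp [ih]

theorem filter {l : α → List β} {f : α → β → Bool} (hl : Pol l)
    (hf : Pol fun p : α × β => f p.1 p.2) : Pol fun x => (l x).filter (f x) :=
  (flatMap hl (f := fun x b => bif f x b then [b] else [])
    (hf.cond (snd.cons (const [])) (const []))).of_eq fun x => by
    induction l x with
    | nil => rfl
    | cons b l ih => cases h : f x b <;> simp [ih, h]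

theorem any {l : α → List β} {f : α → β → Bool} (hl : Pol l)
    (hf : Pol fun p : α × β => f p.1 p.2) : Pol fun x => (l x).any (f x) := by
  refine (foldl (f := fun x a b => a || f x b) hl (const false)
    ((fst.comp snd).or (hf.comp (fst.pair (snd.comp snd)))) (Polynomial.C 3)
    fun x l' _ => ?_).of_eq fun x => ?_
  · rw [Polynomial.eval_C]; exact sz_bool _
  · have : ∀ (m : List β) (a : Bool), m.foldl (fun a b => a || f x b) a = (a || m.any (f x)) := by
      intro m
      induction m with
      | nil => simp
      | cons b m ih => intro a; simp [ih, Bool.or_assoc]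
    simp [this]

theorem all {l : α → List β} {f : α → β → Bool} (hl : Pol l)
    (hf : Pol fun p : α × β => f p.1 p.2) : Pol fun x => (l x).all (f x) :=
  (hl.any (f := fun x b => !f x b) hf.not).not.of_eq fun x => by
    rw [List.all_eq_not_any_not]

theorem takeWhile {l : α → List β} {f : α → β → Bool} (hl : Pol l)
    (hf : Pol fun p : α × β => f p.1 p.2) : Pol fun x => (l x).takeWhile (f x) := by
  -- A fold cannot stop early, so a flag records whether the test has held so far.
  let g : α → List β × Bool → β → List β × Bool := fun x s b =>
    bif s.2 && f x b then (s.1 ++ [b], true) else (s.1, false)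
  have key : ∀ x (m : List β) (s : List β × Bool), (m.foldl (g x) s).1 =
      s.1 ++ bif s.2 then m.takeWhile (f x) else [] := by
    intro x m
    induction m with
    | nil => rintro ⟨s, b⟩; cases b <;> simp
    | cons b m ih =>
      rintro ⟨s, c⟩
      rw [List.foldl_cons, ih]
      cases c <;> cases h : f x b <;> simp [g, h]
  obtain ⟨_, R, hR⟩ := _root_.id hl
  have hp : Pol fun p : α × (List β × Bool) × β => f p.1 p.2.2 := hf.comp (fst.pair (snd.comp snd))
  have hs : Pol fun p : α × (List β × Bool) × β => p.2.1.1 := fst.comp (fst.comp snd)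
  have := foldl (f := g) (i := fun _ => ([], true)) hl (const _)
    (((snd.comp (fst.comp snd)).and hp).cond
      ((hs.append ((snd.comp snd).cons (const []))).pair (const true))
      (hs.pair (const false))) (R + 4) fun x l' hl' => ?_
  · refine (fst.comp this).of_eq fun x => ?_
    rw [key]
    simp
  · have h1 : (l'.foldl (g x) ([], true)).1 = l'.takeWhile (f x) := by rw [key]; simp
    have h2 := sz_pair (l'.foldl (g x) ([], true)).1 (l'.foldl (g x) ([], true)).2
    rw [Prod.mk.eta] at h2
    have h3 := sz_bool (l'.foldl (g x) ([], true)).2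
    have h4 := sz_le_of_sublist ((List.takeWhile_prefix (f x)).sublist.trans hl'.sublist)
    have h5 := (hR x).2
    rw [← h1] at h4
    simp only [Polynomial.eval_add, Polynomial.eval_ofNat]
    omega

/-- One element of `m` is removed for each element of `l`; something is left iff `m` is longer. -/
theorem length_lt {l : α → List β} {m : α → List γ} (hl : Pol l) (hm : Pol m) :
    Pol fun x => decide ((l x).length < (m x).length) := by
  have key : ∀ (u : List β) (v : List γ), u.foldl (fun a _ => a.tail) v = v.drop u.length := by
    intro u
    induction u with
    | nil => simp
    | cons b u ih => intro v; simp [ih]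
  have h : Pol fun x => (l x).foldl (fun a _ => a.tail) (m x) := by
    obtain ⟨_, R, hR⟩ := _root_.id hm
    refine foldl (f := fun _ a _ => a.tail) hl hm (tail (fst.comp snd)) R fun x l' _ => ?_
    rw [key]
    exact (sz_le_of_sublist (List.drop_sublist _ _)).trans (hR x).2
  refine (listCases h (const false) (const true)).of_eq fun x => ?_
  rw [key]
  rcases h : List.drop (l x).length (m x) with _ | ⟨b, t⟩
  · have := List.drop_eq_nil_iff.1 h
    simpa using this
  · have := congrArg List.length h
    simp only [List.length_drop, List.length_cons] at this
    simp only [true_eq_decide_iff]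
    omega

theorem beq_bool : Pol fun p : Bool × Bool => p.1 == p.2 :=
  (cond (fst (α := Bool) (β := Bool)) snd snd.not).of_eq fun ⟨a, b⟩ => by cases a <;> cases b <;> rfl

theorem eq_listBool : Pol fun p : List Bool × List Bool => decide (p.1 = p.2) := by
  let g : Bool × List Bool → Bool → Bool × List Bool := fun s b =>
    (s.1 && (bif decide (([] : List Bool).length < s.2.length) then b == s.2.headD false else false),
      s.2.tail)
  -- The flag says whether `u` is a prefix of `v`, and the second component is the rest of `v`.
  -- Equality means that the flag holds and the rest is empty, that is, shorter than `[()]`.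
  have key : ∀ (u v : List Bool) (c : Bool), u.foldl g (c, v) =
      (c && decide (u <+: v), v.drop u.length) := by
    intro u
    induction u with
    | nil => simp
    | cons b u ih =>
      intro v c
      rw [List.foldl_cons]
      rcases v with _ | ⟨d, v⟩
      · simp only [g, ih]; simp
      · simp only [g, ih]
        cases b <;> cases d <;> simp [List.cons_prefix_cons] <;> congr
  have h2 : Pol fun p : (List Bool × List Bool) × (Bool × List Bool) × Bool => p.2.1.2 :=
    snd.comp (fst.comp snd)
  have hg : Pol fun p : (List Bool × List Bool) × (Bool × List Bool) × Bool => g p.2.1 p.2.2 :=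
    ((fst.comp (fst.comp snd)).and (((const ([] : List Bool)).length_lt h2).cond
      (beq_bool.comp ((snd.comp snd).pair (h2.headD (const false)))) (const false))).pair h2.tail
  have hi : Pol fun p : List Bool × List Bool => (true, p.2) := (const true).pair snd
  have h : Pol fun p : List Bool × List Bool => p.1.foldl g (true, p.2) := by
    refine foldl (f := fun _ => g) fst hi hg (Polynomial.X + 4) fun p l' _ => ?_
    rw [key]
    have h3 := sz_bool (true && decide (l' <+: p.2))
    have h4 := sz_le_of_sublist (List.drop_sublist l'.length p.2)
    have h5 := sz_pair p.1 p.2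
    rw [Prod.mk.eta] at h5
    simp only [sz_pair, Polynomial.eval_add, Polynomial.eval_ofNat, Polynomial.eval_X]
    omega
  refine ((fst.comp h).and ((snd.comp h).length_lt (const [()]))).of_eq fun ⟨u, v⟩ => ?_
  simp only [key, Bool.true_and]
  rw [← Bool.decide_and]
  congr 1
  apply propext
  constructor
  · rintro ⟨⟨w, rfl⟩, hw⟩
    have : w = [] := by simpa using hw
    simp [this]
  · rintro rfl
    simp

theorem eq_nat {f g : α → ℕ} (hf : Pol f) (hg : Pol g) : Pol fun x => decide (f x = g x) := by
  have h1 : Pol encodeNat := of_enc_eq fun _ => rfl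
  refine (eq_listBool.comp ((h1.comp hf).pair (h1.comp hg))).of_eq fun x => ?_
  congr 1
  apply propext
  constructor
  · intro h
    have := congrArg decodeNat h
    simpa using this
  · intro h; simp [h]

theorem mem_nat {f : α → ℕ} {l : α → List ℕ} (hf : Pol f) (hl : Pol l) :
    Pol fun x => decide (f x ∈ l x) :=
  (hl.any (f := fun x b => decide (f x = b)) (eq_nat (hf.comp fst) snd)).of_eq fun x => by
    rw [Bool.eq_iff_iff]
    simp

end Pol

/-! ### Running a program on an input string -/

/-- A symbol as a pair of bits. -/
def conv : Γ' → Bool × Bool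
  | .bit b => (true, b)
  | .comma => (false, true)
  -- Among these symbols only `ket` occurs in the encodings of instances.
  | _ => (false, false)

/-- Push several bits on the data stack. -/
def pushes {Λ : Type} (l : List Bool) (q : St Λ) : St Λ :=
  -- The fold puts the last bit outermost, hence pushes it first, and `l` stands on the stack in
  -- reading order.
  l.foldl (fun q b => .push .data (fun _ => b) q) q

/-- Push a symbol on the data stack. -/
def pushSymbol {Λ : Type} (q : St Λ) : St Λ :=
  .branch (fun v => decide (v = some .comma)) (pushes (true :: (enc (false, true)).code) q) <|
  .branch (fun v => decide (v = some (.bit true))) (pushes (true :: (enc (true, true)).code) q) <|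
  .branch (fun v => decide (v = some (.bit false))) (pushes (true :: (enc (true, false)).code) q) <|
  pushes (true :: (enc (false, false)).code) q

/-- The machine that converts the input string into a list, runs a program, and turns the resulting
tree into an output bit. -/
def machine (c : Code) : Lab c ⊕ Fin 3 → St (Lab c ⊕ Fin 3) :=
  Sum.elim (stmt c Sum.inl (Sum.inr 2)) fun i =>
    -- Label `0` creates the empty list, label `1` conses the input symbols onto it, and label `2`
    -- produces the output.
    if i = 0 then .push .data (fun _ => false) (jump (.inr 1))
    else if i = 1 then
      .pop .inp (fun _ x => x) <| .branch Option.isNone (jump (.inl (entry c)))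
        (pushSymbol (jump (.inr 1)))
    else
      -- The tree of `true` has three symbols and that of `false` has one; all must go, since a
      -- halting configuration has only the output stack nonempty.
      .pop .data popBit <| .branch bitOf
        (.pop .data popBit <| .pop .data popBit <| .push .out (fun _ => true) <|
          .load (fun _ => none) .halt)
        (.push .out (fun _ => false) <| .load (fun _ => none) .halt)

/-- Each symbol is put in front of those read before it, which reverses the input. -/
theorem machine_convert (c : Code) (s : List Γ') (l : List (Bool × Bool)) :
    Reach (machine c) (s.length + 1)
      ⟨some (.inr 1), none, allStk s (enc l).code [] [] [] []⟩
      (conf (.inl (entry c)) (enc ((s.map conv).reverse ++ l)).code [] [] []) := by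
  induction s generalizing l with
  | nil =>
    apply Reach.single
    simp [machine, jump, conf]
  | cons a s ih =>
    have h := ih (conv a :: l)
    simp only [List.map_cons, List.reverse_cons, List.append_assoc, List.singleton_append]
    refine Reach.head ?_ h
    rcases a with _ | b | _ | _ | _
    all_goals try cases b
    all_goals
      simp [machine, pushSymbol, pushes, jump, conv, enc, encList, Bin.code]

theorem machine_finish (c : Code) (b : Bool) :
    TM2.step (machine c) (conf (.inr 2) (enc b).code [] [] []) =
      some ⟨none, none, allStk [] [] [] [] [] [b]⟩ := by
  cases b <;> simp [machine, conf, enc, Bin.code, popBit, bitOf]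

end PolyTime

/-! ### From programs to membership in P -/

namespace PolyTime

open Turing Computability
open Enc (enc)

/-- The machine, as a bundled machine with input and output. -/
noncomputable def finMachine (c : Code) : FinTM2 where
  K := Stk
  k₀ := .inp
  k₁ := .out
  Γ := Alph
  Λ := Lab c ⊕ Fin 3
  main := .inr 0
  σ := Option Γ'
  initialState := none
  Γk₀Fin := inferInstanceAs (Fintype Γ')
  m := machine c

theorem initList_finMachine (c : Code) (s : List Γ') :
    initList (finMachine c) s = (⟨some (.inr 0), none, allStk s [] [] [] [] []⟩ : Conf _) := by
  have : (initList (finMachine c) s).stk = allStk s [] [] [] [] [] := by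
    funext k; cases k <;> rfl
  exact congrArg (fun S => (⟨some (.inr 0), none, S⟩ : Conf (Lab c ⊕ Fin 3))) this

theorem haltList_finMachine (c : Code) (s : List Bool) :
    haltList (finMachine c) s = (⟨none, none, allStk [] [] [] [] [] s⟩ : Conf _) := by
  have : (haltList (finMachine c) s).stk = allStk [] [] [] [] [] s := by
    funext k; cases k <;> rfl
  exact congrArg (fun S => (⟨none, none, S⟩ : Conf (Lab c ⊕ Fin 3))) this

theorem machine_start (c : Code) (s : List Γ') :
    TM2.step (machine c) ⟨some (.inr 0), none, allStk s [] [] [] [] []⟩ =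
      some ⟨some (.inr 1), none, allStk s (enc ([] : List (Bool × Bool))).code [] [] [] []⟩ := by
  simp [machine, jump, enc, encList, Bin.code]

theorem sz_conv (s : List Γ') : sz (s.map conv).reverse ≤ 8 * s.length + 1 := by
  rw [sz_reverse]
  -- `7` is two booleans of size at most `3` and a pair node.
  have := sz_le_length_mul (l := s.map conv) (N := 7) fun a _ => by
    have h1 := sz_bool a.1
    have h2 := sz_bool a.2
    have h3 := sz_pair a.1 a.2
    rw [Prod.mk.eta] at h3
    omega
  rw [List.length_map] at this
  omega

/-- A decision problem is in P if the string of an instance can be turned into a representation of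
some datum in polynomial time, and the answer computed from this datum in polynomial time. -/
theorem inP {α β γ : Type} [Enc β] [Enc γ] (e : α → List Γ') (p : α → Prop)
    {g : List (Bool × Bool) → β} (hg : Pol g) {h : γ → Bool} (hh : Pol h) (t : α → γ)
    (ht : ∀ x, enc (g ((e x).map conv).reverse) = enc (t x)) (hp : ∀ x, h (t x) = true ↔ p x) :
    SeqAlloc.InP e p := by
  classical
  obtain ⟨c, P, hc⟩ := hg
  obtain ⟨d, Q, hd⟩ := hh
  let M : FinTM2 := finMachine (.seq c d)
  let B : Polynomial ℕ := P.comp (8 * Polynomial.X + 1)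
  -- The summands are the start, the conversion of the input, the two programs and the output.
  let T : Polynomial ℕ := 1 + (Polynomial.X + 1) + (B + Q.comp B) + 1
  have key : ∀ x, Reach (machine (.seq c d)) (T.eval (e x).length)
      ⟨some (.inr 0), none, allStk (e x) [] [] [] [] []⟩
      ⟨none, none, allStk [] [] [] [] [] [h (t x)]⟩ := by
    intro x
    have h1 := machine_convert (.seq c d) (e x) []
    rw [List.append_nil] at h1
    have hs := eval_mono P (sz_conv (e x))
    obtain ⟨h2, h3⟩ := hc ((e x).map conv).reverse
    obtain ⟨h4, -⟩ := hd (t x)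
    have hsz : sz (t x) = sz (g ((e x).map conv).reverse) := by rw [sz, sz, ht]
    rw [ht] at h2
    have h5 := (h2.seq h4) [] _ (machine (.seq c d)) Sum.inl (.inr 2) fun l => rfl
    simp only [List.append_nil] at h5
    have h6 := (((Reach.single (machine_start (.seq c d) (e x))).trans h1).trans h5).trans
      (Reach.single (machine_finish _ _))
    refine h6.mono ?_
    have h7 := eval_mono Q ((hsz.le.trans h3).trans hs)
    simp only [T, B, Polynomial.eval_add, Polynomial.eval_comp, Polynomial.eval_mul,
      Polynomial.eval_X, Polynomial.eval_one, Polynomial.eval_ofNat]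
    omega
  refine ⟨{ tm := M, inputAlphabet := Equiv.refl _, outputAlphabet := Equiv.refl _, time := T,
            outputsFun := fun x => ?_ }⟩
  have hx := key x
  refine ⟨⟨hx.choose, ?_⟩, hx.choose_spec.1⟩
  have h2 := hx.choose_spec.2
  have e1 : List.map (Equiv.refl (M.Γ M.k₀)).invFun (e x) = e x := List.map_id _
  have e2 : List.map (Equiv.refl (M.Γ M.k₁)).invFun (encodeBool (decide (p x))) = [h (t x)] := by
    have : decide (p x) = h (t x) := by rw [Bool.eq_iff_iff, hp]; simp
    exact (List.map_id _).trans (congrArg (fun b => [b]) this)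
  refine Eq.trans ?_ (h2.trans ?_)
  · exact congrArg (fun z => (flip bind (TM2.step (machine (.seq c d))))^[hx.choose] (some z))
      ((congrArg (initList M) e1).trans (initList_finMachine _ _))
  · exact congrArg some ((congrArg (haltList M) e2).trans (haltList_finMachine _ _)).symm

end PolyTime

/-! ### Loops whose data grow by a bounded amount in each pass -/

namespace PolyTime

open Turing Computability
open Enc (enc)

theorem enc_map {α β : Type} [Enc α] [Enc β] {f : α → β} (h : ∀ a, enc (f a) = enc a) (l : List α) :
    enc (l.map f) = enc l := by
  induction l with
  | nil => rfl
  | cons a l ih =>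
    change Bin.cons (enc (f a)) (enc (l.map f)) = Bin.cons (enc a) (enc l)
    rw [h, ih]

theorem sz_foldl_le {β γ : Type} [Enc γ] {f : γ → β → γ} {K : ℕ} (l : List β) (a : γ)
    (h : ∀ a, ∀ b ∈ l, sz (f a b) ≤ sz a + K) : sz (l.foldl f a) ≤ sz a + l.length * K := by
  induction l generalizing a with
  | nil => simp
  | cons b l ih =>
    have h1 := ih (f a b) fun a c hc => h a c (by simp [hc])
    have h2 := h a b (by simp)
    simp only [List.foldl_cons, List.length_cons, Nat.succ_mul]
    omega

/-- With additive growth the accumulator stays below its initial size plus the number of passes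
times the increment. The parser and the auction are loops of this kind. -/
theorem Pol.foldl_of_growth {α β γ : Type} [Enc α] [Enc β] [Enc γ] {l : α → List β} {i : α → γ}
    {f : α → γ → β → γ} (hl : Pol l) (hi : Pol i)
    (hf : Pol fun p : α × γ × β => f p.1 p.2.1 p.2.2) (G : Polynomial ℕ)
    (hG : ∀ x a, ∀ b ∈ l x, sz (f x a b) ≤ sz a + G.eval (sz x)) :
    Pol fun x => (l x).foldl (f x) (i x) := by
  obtain ⟨_, R, hR⟩ := _root_.id hl
  obtain ⟨_, S, hS⟩ := _root_.id hi
  refine foldl hl hi hf (S + R * G) fun x l' hl' => ?_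
  refine (sz_foldl_le l' (i x) fun a b hb => hG x a b (hl'.subset hb)).trans ?_
  simp only [Polynomial.eval_add, Polynomial.eval_mul]
  gcongr
  · exact (hS x).2
  · exact hl'.length_le.trans ((length_lt_sz _).le.trans (hR x).2)

end PolyTime

/-! ### The algorithm -/

namespace SeqAlloc

open PolyTime Computability
open Enc (enc)

/-- Read one symbol of a table, from right to left. -/
def parseStep (t : List (List (List Bool))) (s : Bool × Bool) : List (List (List Bool)) :=
  -- From right to left a terminator precedes what it terminates: `ket` opens a row, `comma` opens a
  -- name, and a bit extends the current name. On encoded tables the defaults of `headD` are never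
  -- used.
  bif s.1 then ((s.2 :: (t.headD []).headD []) :: (t.headD []).tail) :: t.tail
  else bif s.2 then ([] :: t.headD []) :: t.tail
  else [] :: t

/-- Read a reversed table. -/
def parse (l : List (Bool × Bool)) : List (List (List Bool)) := l.foldl parseStep []

theorem parse_reverse (l : List (Bool × Bool)) :
    parse l.reverse = l.foldr (fun s t => parseStep t s) [] := by
  rw [parse, List.foldl_reverse]

theorem parse_name (bits nm : List Bool) (r : List (List Bool)) (t : List (List (List Bool))) :
    ((bits.map Γ'.bit).map conv).foldr (fun s t => parseStep t s) ((nm :: r) :: t) =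
      ((bits ++ nm) :: r) :: t := by
  induction bits with
  | nil => rfl
  | cons b bits ih => simp only [List.map_cons, List.foldr_cons, ih]; rfl

theorem parse_row (l : List ℕ) (t : List (List (List Bool))) :
    ((encRow l).map conv).foldr (fun s t => parseStep t s) ([] :: t) =
      l.map encodeNat :: t := by
  induction l with
  | nil => rfl
  | cons i l ih =>
    have h : encRow (i :: l) = (encodeNat i).map Γ'.bit ++ Γ'.comma :: encRow l := by
      simp [encRow, encName]
    rw [h, List.map_append, List.foldr_append, List.map_cons, List.foldr_cons, ih]
    have := parse_name (encodeNat i) [] (l.map encodeNat) t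
    rw [List.append_nil] at this
    exact this

theorem parse_encTable (t : List (List ℕ)) :
    parse ((encTable t).map conv).reverse = t.map (List.map encodeNat) := by
  rw [parse_reverse]
  induction t with
  | nil => rfl
  | cons l t ih =>
    have h : encTable (l :: t) = encRow l ++ Γ'.ket :: encTable t := by simp [encTable]
    rw [h, List.map_append, List.foldr_append, List.map_cons, List.foldr_cons, ih]
    exact parse_row l _

/-- The parser yields numerals as bit lists, whose trees are those of the numbers; no decoding is
needed. -/
theorem enc_parse (t : List (List ℕ)) :
    enc (parse ((encTable t).map conv).reverse) = enc t := by
  rw [parse_encTable]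
  exact enc_map (f := List.map encodeNat) (enc_map (f := encodeNat) fun _ => rfl) t

theorem pol_parse : Pol parse := by
  have hs1 : Pol fun p : List (Bool × Bool) × List (List (List Bool)) × (Bool × Bool) => p.2.2.1 :=
    Pol.fst.comp (Pol.snd.comp Pol.snd)
  have hs2 : Pol fun p : List (Bool × Bool) × List (List (List Bool)) × (Bool × Bool) => p.2.2.2 :=
    Pol.snd.comp (Pol.snd.comp Pol.snd)
  have ht : Pol fun p : List (Bool × Bool) × List (List (List Bool)) × (Bool × Bool) => p.2.1 :=
    Pol.fst.comp Pol.snd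
  have hh := ht.headD (Pol.const [])
  have hf : Pol fun p : List (Bool × Bool) × List (List (List Bool)) × (Bool × Bool) =>
      parseStep p.2.1 p.2.2 :=
    hs1.cond (((hs2.cons (hh.headD (Pol.const []))).cons hh.tail).cons ht.tail)
      (hs2.cond (((Pol.const []).cons hh).cons ht.tail) ((Pol.const []).cons ht))
  refine Pol.foldl_of_growth (f := fun _ => parseStep) Pol.id (Pol.const []) hf (Polynomial.C 20)
    fun x t s _ => ?_
  rw [Polynomial.eval_C]
  obtain ⟨s1, s2⟩ := s
  have := sz_bool s2
  cases s1 <;> cases s2 <;> rcases t with _ | ⟨_ | ⟨nm, r⟩, t⟩ <;>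
    simp [parseStep] at * <;> omega

/-- An object that can be assigned to one item: one of the turns of an agent. It consists of the
name of the agent, the items that may be assigned, the price (in unary), and the item assigned to
it at the moment (if there is one). -/
abbrev Slot := ℕ × List ℕ × List Unit × List ℕ

namespace Slot
/-- The agent. -/
abbrev agent (s : Slot) : ℕ := s.1
/-- The items that may be assigned. -/
abbrev allowed (s : Slot) : List ℕ := s.2.1
/-- The price, in unary. -/
abbrev price (s : Slot) : List Unit := s.2.2.1
/-- The item that is assigned. -/
abbrev owner (s : Slot) : List ℕ := s.2.2.2
end Slot

/-- Compare a slot with the cheapest slot for `w` found before. -/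
def bidStep (w : ℕ) (st : List Slot × List Slot) (s : Slot) : List Slot × List Slot :=
  bif decide (w ∈ s.allowed) then
    -- If no candidate has been found, the default `s` makes this strict comparison fail, and the
    -- last branch makes `s` the candidate.
    bif decide (s.price.length < (st.1.headD s).price.length) then (s :: st.1.tail, st.1.headD s :: st.2)
    else bif decide (([] : List Slot).length < st.1.length) then (st.1, s :: st.2)
    else ([s], st.2)
  else (st.1, s :: st.2)

/-- Assign `w` to a slot. -/
def Slot.assign (w : ℕ) (s : Slot) : Slot := (s.agent, s.allowed, () :: s.price, [w])

/-- The item `w` bids for a cheapest slot that is allowed for it. -/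
def bid (w : ℕ) (l : List Slot) : List Slot :=
  (l.foldl (bidStep w) ([], [])).1.map (Slot.assign w) ++ (l.foldl (bidStep w) ([], [])).2

/-- The items without a slot. -/
def unassigned (W : List ℕ) (l : List Slot) : List ℕ :=
  W.filter fun w => !l.any fun s => decide (w ∈ s.owner)

/-- A step of the auction. -/
def auctionStep (W : List ℕ) (l : List Slot) : List Slot :=
  bif decide (([] : List ℕ).length < (unassigned W l).length) then bid ((unassigned W l).headD 0) l
  else l

/-- Is it possible to assign all items of `W` to different slots? The auction is run for as many
steps as the list `T` has elements. -/
def matchable (T W : List ℕ) (l : List Slot) : Bool :=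
  !decide (([] : List ℕ).length < (unassigned W (T.foldl (fun l _ => auctionStep W l) l)).length)

/-- The preference list of an agent in a table. -/
def prefsOf (a : ℕ) (t : List (List ℕ)) : List ℕ :=
  t.flatMap fun r => bif decide (r.headD 0 = a) then r.tail else []

/-- The slots of the agents other than `a`: `k` for each agent, and an agent may be assigned the
items that she prefers to all items in `I`. -/
def slotsOf (k a : ℕ) (t : List (List ℕ)) (I : List ℕ) : List Slot :=
  t.flatMap fun r => bif decide (r.headD 0 = a) then [] else
    List.replicate k (r.headD 0, r.tail.takeWhile (fun c => !decide (c ∈ I)), [], [])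

/-- All lists of `r` elements of `l`. -/
def tuples (l : List ℕ) : ℕ → List (List ℕ)
  | 0 => [[]]
  | r + 1 => l.flatMap fun x => (tuples l r).map (List.cons x)

/-- The items that are preferred to `o`. -/
def better (a o : ℕ) (t : List (List ℕ)) : List ℕ :=
  (prefsOf a t).takeWhile fun c => !decide (c = o)

/-- Can agent `a` get the items of `S`, without `o`, by picking all items that she prefers to `o`
first, and the other items of `S` last? -/
def avoids (k a o : ℕ) (t : List (List ℕ)) (S : List ℕ) : Bool :=
  !decide (o ∈ S) && ((better a o t).all (fun c => decide (c ∈ S)) &&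
    -- Only the length of this list matters: the square of the number of items, which is at least
    -- the number of bids needed.
    matchable ((prefsOf a t).flatMap fun _ => prefsOf a t)
      ((prefsOf a t).filter fun c => !decide (c ∈ S))
      (slotsOf k a t (S.filter fun c => !decide (c ∈ better a o t))))

/-- Does agent `a` get the item `o` under all balanced policies? -/
def alwaysGets (k a : ℕ) (t : List (List ℕ)) (o : ℕ) : Bool :=
  decide ((better a o t).length < (List.replicate k ()).length) &&
    !(tuples (prefsOf a t) k).any (avoids k a o t)

/-- The agent, the items and the profile in the table of an instance. -/
def answerAll (k : ℕ) (t : List (List ℕ)) : Bool :=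
  -- A single item is a row of length one, so one test serves both the item and the subset problem.
  (t.tail.headD []).all (alwaysGets k ((t.headD []).headD 0) t.tail.tail)

/-- The answer for sets. -/
def answerSet (k : ℕ) (t : List (List ℕ)) : Bool :=
  -- The two negated comparisons say that the set has exactly `k` elements.
  answerAll k t && (!decide ((t.tail.headD []).length < (List.replicate k ()).length) &&
    !decide ((List.replicate k ()).length < (t.tail.headD []).length))

/-! ### The algorithm runs in polynomial time -/

section pol
variable {α : Type} [Enc α]

theorem sz_slot (s : Slot) :
    sz s = sz s.agent + sz s.allowed + sz s.price + sz s.owner + 3 := by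
  obtain ⟨a, b, c, d⟩ := s
  change sz (a, b, c, d) = sz a + sz b + sz c + sz d + 3
  simp only [sz_pair]
  omega

theorem sz_bidStep (w : ℕ) (st : List Slot × List Slot) (s : Slot) :
    sz (bidStep w st s).1 + sz (bidStep w st s).2 = sz st.1 + sz st.2 + sz s + 1 := by
  obtain ⟨b, r⟩ := st
  unfold bidStep
  rcases b with _ | ⟨b, t⟩ <;> (repeat' rw [Bool.cond_decide]) <;> split_ifs <;> simp at * <;> omega

theorem sz_foldl_bidStep (w : ℕ) (l : List Slot) (st : List Slot × List Slot) :
    sz (l.foldl (bidStep w) st).1 + sz (l.foldl (bidStep w) st).2 + 1 =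
      sz st.1 + sz st.2 + sz l := by
  induction l generalizing st with
  | nil => simp
  | cons s l ih =>
    have := sz_bidStep w st s
    rw [List.foldl_cons, ih, sz_cons]
    omega

theorem length_bidStep (w : ℕ) (st : List Slot × List Slot) (s : Slot) (h : st.1.length ≤ 1) :
    (bidStep w st s).1.length ≤ 1 := by
  obtain ⟨b, r⟩ := st
  unfold bidStep
  rcases b with _ | ⟨b, t⟩ <;> (repeat' rw [Bool.cond_decide]) <;> split_ifs <;> simp at * <;>
    assumption

theorem length_foldl_bidStep (w : ℕ) (l : List Slot) (st : List Slot × List Slot)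
    (h : st.1.length ≤ 1) : (l.foldl (bidStep w) st).1.length ≤ 1 := by
  induction l generalizing st with
  | nil => exact h
  | cons s l ih => exact ih _ (length_bidStep w st s h)

/-- Only one slot changes, since at most one candidate is kept: its price gains one unit and its
owner is replaced by `w`. -/
theorem sz_bid (w : ℕ) (l : List Slot) : sz (bid w l) ≤ sz l + sz w + 10 := by
  have h1 := sz_foldl_bidStep w l ([], [])
  have h2 := length_foldl_bidStep w l ([], []) (by simp)
  rw [bid]
  generalize l.foldl (bidStep w) ([], []) = st at *
  obtain ⟨b, r⟩ := st
  have h3 := sz_append (b.map (Slot.assign w)) r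
  simp only [sz_nil] at h1
  rcases b with _ | ⟨b, _ | ⟨c, t⟩⟩
  · simp at *
    omega
  · have h4 := sz_slot b
    have h5 := sz_slot (Slot.assign w b)
    have h6 : sz (Slot.assign w b).price = sz b.price + 2 := by
      have : sz (() :: b.price) = sz () + sz b.price + 1 := sz_cons _ _
      have h : sz () = 1 := rfl
      change sz (() :: b.price) = _
      omega
    have h7 : sz (Slot.assign w b).owner = sz w + 2 := by
      have : sz [w] = sz w + 1 + 1 := sz_cons _ _
      exact this
    have h8 : (Slot.assign w b).agent = b.agent := rfl
    have h9 : (Slot.assign w b).allowed = b.allowed := rfl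
    simp only [List.map_cons, List.map_nil, sz_cons, sz_nil] at *
    rw [h8, h9] at h5
    omega
  · simp at h2

theorem sz_auctionStep (W : List ℕ) (l : List Slot) : sz (auctionStep W l) ≤ sz l + sz W + 20 := by
  rw [auctionStep, Bool.cond_decide]
  split_ifs with h
  · have h1 := sz_bid ((unassigned W l).headD 0) l
    rcases hu : unassigned W l with _ | ⟨w, u⟩
    · simp [hu] at h
    · have : w ∈ W := List.mem_of_mem_filter (hu ▸ List.mem_cons_self : w ∈ unassigned W l)
      have := sz_lt_of_mem this
      rw [hu, List.headD_cons] at h1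
      rw [List.headD_cons]
      omega
  · omega

theorem pol_bidStep {w : α → ℕ} {st : α → List Slot × List Slot} {s : α → Slot} (hw : Pol w)
    (hst : Pol st) (hs : Pol s) : Pol fun x => bidStep (w x) (st x) (s x) := by
  have h1 := Pol.fst.comp hst
  have h2 := Pol.snd.comp hst
  have hp : Pol fun s : Slot => s.price := Pol.fst.comp (Pol.snd.comp Pol.snd)
  have ha : Pol fun s : Slot => s.allowed := Pol.fst.comp Pol.snd
  have hb := h1.headD hs
  exact (hw.mem_nat (ha.comp hs)).cond
    (((hp.comp hs).length_lt (hp.comp hb)).cond ((hs.cons h1.tail).pair (hb.cons h2))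
      (((Pol.const ([] : List Slot)).length_lt h1).cond (h1.pair (hs.cons h2))
        ((hs.cons (Pol.const [])).pair h2)))
    (h1.pair (hs.cons h2))

theorem pol_bid {w : α → ℕ} {l : α → List Slot} (hw : Pol w) (hl : Pol l) :
    Pol fun x => bid (w x) (l x) := by
  have hf : Pol fun p : (ℕ × List Slot) × (List Slot × List Slot) × Slot =>
      bidStep p.1.1 p.2.1 p.2.2 :=
    pol_bidStep (Pol.fst.comp Pol.fst) (Pol.fst.comp Pol.snd) (Pol.snd.comp Pol.snd)
  have h1 : Pol fun p : ℕ × List Slot => p.2.foldl (bidStep p.1) ([], []) := by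
    refine Pol.foldl (f := fun p : ℕ × List Slot => bidStep p.1) Pol.snd (Pol.const _) hf
      (Polynomial.X + 10) fun p l' hl' => ?_
    have h2 := sz_foldl_bidStep p.1 l' ([], [])
    have h3 := sz_le_of_sublist hl'.sublist
    have h4 := sz_pair p.1 p.2
    have h5 := sz_pair (l'.foldl (bidStep p.1) ([], [])).1 (l'.foldl (bidStep p.1) ([], [])).2
    rw [Prod.mk.eta] at h4 h5
    simp only [sz_nil] at h2
    simp only [Polynomial.eval_add, Polynomial.eval_X, Polynomial.eval_ofNat]
    omega
  have hpr : Pol fun p : ℕ × Slot => () :: p.2.price :=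
    (Pol.const ()).cons (Pol.fst.comp (Pol.snd.comp (Pol.snd.comp Pol.snd)))
  have hag : Pol fun p : ℕ × Slot => p.2.agent := Pol.fst.comp Pol.snd
  have hal : Pol fun p : ℕ × Slot => p.2.allowed := Pol.fst.comp (Pol.snd.comp Pol.snd)
  have how : Pol fun p : ℕ × Slot => [p.1] := Pol.fst.cons (Pol.const [])
  have h2 : Pol fun p : ℕ × Slot => Slot.assign p.1 p.2 := hag.pair (hal.pair (hpr.pair how))
  have h3 : Pol fun p : ℕ × List Slot =>
      (p.2.foldl (bidStep p.1) ([], [])).1.map (Slot.assign p.1) :=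
    (Pol.fst.comp h1).map (f := fun p : ℕ × List Slot => Slot.assign p.1)
      (h2.comp₂ (Pol.fst.comp Pol.fst) Pol.snd)
  have h4 : Pol fun p : ℕ × List Slot => bid p.1 p.2 := h3.append (Pol.snd.comp h1)
  exact h4.comp₂ hw hl

theorem pol_unassigned {W : α → List ℕ} {l : α → List Slot} (hW : Pol W) (hl : Pol l) :
    Pol fun x => unassigned (W x) (l x) := by
  refine hW.filter (f := fun x w => !(l x).any fun s => decide (w ∈ s.owner)) ?_
  refine Pol.not (Pol.any (f := fun (p : α × ℕ) (s : Slot) => decide (p.2 ∈ s.owner))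
    (hl.comp Pol.fst) ?_)
  exact Pol.mem_nat (Pol.snd.comp Pol.fst) (Pol.snd.comp (Pol.snd.comp (Pol.snd.comp Pol.snd)))

theorem pol_auctionStep {W : α → List ℕ} {l : α → List Slot} (hW : Pol W) (hl : Pol l) :
    Pol fun x => auctionStep (W x) (l x) :=
  ((Pol.const ([] : List ℕ)).length_lt (pol_unassigned hW hl)).cond
    (pol_bid ((pol_unassigned hW hl).headD (Pol.const 0)) hl) hl

theorem pol_matchable {T W : α → List ℕ} {l : α → List Slot} (hT : Pol T) (hW : Pol W)
    (hl : Pol l) : Pol fun x => matchable (T x) (W x) (l x) := by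
  obtain ⟨_, R, hR⟩ := id hW
  have h : Pol fun x => (T x).foldl (fun l _ => auctionStep (W x) l) (l x) := by
    refine Pol.foldl_of_growth (f := fun x l _ => auctionStep (W x) l) hT hl
      (pol_auctionStep (hW.comp Pol.fst) (Pol.fst.comp Pol.snd)) (R + 20) fun x l w _ => ?_
    have h1 := sz_auctionStep (W x) l
    have h2 := (hR x).2
    simp only [Polynomial.eval_add, Polynomial.eval_ofNat]
    omega
  exact ((Pol.const ([] : List ℕ)).length_lt (pol_unassigned hW h)).not

theorem pol_prefsOf {a : α → ℕ} {t : α → List (List ℕ)} (ha : Pol a) (ht : Pol t) :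
    Pol fun x => prefsOf (a x) (t x) := by
  have h2 : Pol fun p : α × List ℕ => p.2.headD 0 := Pol.snd.headD (Pol.const 0)
  have h3 : Pol fun p : α × List ℕ => bif decide (p.2.headD 0 = a p.1) then p.2.tail else [] :=
    (h2.eq_nat (ha.comp Pol.fst)).cond Pol.snd.tail (Pol.const [])
  exact ht.flatMap (f := fun x r => bif decide (r.headD 0 = a x) then r.tail else []) h3

theorem pol_slotsOf (k : ℕ) {a : α → ℕ} {t : α → List (List ℕ)} {I : α → List ℕ} (ha : Pol a)
    (ht : Pol t) (hI : Pol I) : Pol fun x => slotsOf k (a x) (t x) (I x) := by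
  have h1 : Pol fun p : α × List ℕ => p.2.tail.takeWhile fun c => !decide (c ∈ I p.1) :=
    Pol.snd.tail.takeWhile (f := fun (p : α × List ℕ) c => !decide (c ∈ I p.1))
      (Pol.not (Pol.mem_nat Pol.snd (hI.comp (Pol.fst.comp Pol.fst))))
  have h2 : Pol fun p : α × List ℕ => p.2.headD 0 := Pol.snd.headD (Pol.const 0)
  have h3 : Pol fun p : α × List ℕ =>
      ((p.2.headD 0, p.2.tail.takeWhile (fun c => !decide (c ∈ I p.1)), [], []) : Slot) :=
    h2.pair (h1.pair ((Pol.const ([] : List Unit)).pair (Pol.const ([] : List ℕ))))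
  have h4 : Pol fun p : α × List ℕ => bif decide (p.2.headD 0 = a p.1) then [] else
      List.replicate k
        ((p.2.headD 0, p.2.tail.takeWhile (fun c => !decide (c ∈ I p.1)), [], []) : Slot) :=
    (h2.eq_nat (ha.comp Pol.fst)).cond (Pol.const []) (Pol.replicate k h3)
  exact ht.flatMap (f := fun x r => bif decide (r.headD 0 = a x) then [] else
      List.replicate k (r.headD 0, r.tail.takeWhile (fun c => !decide (c ∈ I x)), [], [])) h4

/-- The degree of the polynomial grows with `r`; this is where it matters that `k` is a constant. -/
theorem pol_tuples {l : α → List ℕ} (hl : Pol l) (r : ℕ) : Pol fun x => tuples (l x) r := by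
  induction r with
  | zero => exact Pol.const [[]]
  | succ r ih =>
    have h1 : Pol fun p : (α × ℕ) × List ℕ => p.1.2 :: p.2 := (Pol.snd.comp Pol.fst).cons Pol.snd
    have h2 : Pol fun p : α × ℕ => (tuples (l p.1) r).map (List.cons p.2) :=
      (ih.comp Pol.fst).map (f := fun p : α × ℕ => List.cons p.2) h1
    exact hl.flatMap (f := fun x i => (tuples (l x) r).map (List.cons i)) h2

theorem pol_better {a o : α → ℕ} {t : α → List (List ℕ)} (ha : Pol a) (ho : Pol o) (ht : Pol t) :
    Pol fun x => better (a x) (o x) (t x) :=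
  (pol_prefsOf ha ht).takeWhile (f := fun x c => !decide (c = o x))
    (Pol.not (Pol.snd.eq_nat (ho.comp Pol.fst)))

theorem pol_avoids (k : ℕ) {a o : α → ℕ} {t : α → List (List ℕ)} {S : α → List ℕ} (ha : Pol a)
    (ho : Pol o) (ht : Pol t) (hS : Pol S) : Pol fun x => avoids k (a x) (o x) (t x) (S x) := by
  have hp := pol_prefsOf ha ht
  have hb := pol_better ha ho ht
  have h1 : Pol fun x => (better (a x) (o x) (t x)).all fun c => decide (c ∈ S x) :=
    hb.all (f := fun x c => decide (c ∈ S x)) (Pol.snd.mem_nat (hS.comp Pol.fst))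
  have h2 : Pol fun x => (prefsOf (a x) (t x)).flatMap fun _ => prefsOf (a x) (t x) :=
    hp.flatMap (f := fun x _ => prefsOf (a x) (t x)) (hp.comp Pol.fst)
  have h3 : Pol fun x => (prefsOf (a x) (t x)).filter fun c => !decide (c ∈ S x) :=
    hp.filter (f := fun x c => !decide (c ∈ S x)) (Pol.not (Pol.snd.mem_nat (hS.comp Pol.fst)))
  have h4 : Pol fun x => (S x).filter fun c => !decide (c ∈ better (a x) (o x) (t x)) :=
    hS.filter (f := fun x c => !decide (c ∈ better (a x) (o x) (t x)))
      (Pol.not (Pol.snd.mem_nat (hb.comp Pol.fst)))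
  exact (ho.mem_nat hS).not.and (h1.and (pol_matchable h2 h3 (pol_slotsOf k ha ht h4)))

theorem pol_alwaysGets (k : ℕ) {a o : α → ℕ} {t : α → List (List ℕ)} (ha : Pol a)
    (ht : Pol t) (ho : Pol o) : Pol fun x => alwaysGets k (a x) (t x) (o x) :=
  ((pol_better ha ho ht).length_lt (Pol.const (List.replicate k ()))).and
    (((pol_tuples (pol_prefsOf ha ht) k).any (f := fun x => avoids k (a x) (o x) (t x))
      (pol_avoids k (ha.comp Pol.fst) (ho.comp Pol.fst) (ht.comp Pol.fst) Pol.snd)).not)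

theorem pol_answerAll (k : ℕ) : Pol (answerAll k) := by
  have h0 : Pol fun t : List (List ℕ) => t := Pol.id
  have h1 : Pol fun t : List (List ℕ) => t.tail.headD [] := h0.tail.headD (Pol.const [])
  have h2 : Pol fun p : List (List ℕ) × ℕ => p.1 := Pol.fst
  have h3 : Pol fun p : List (List ℕ) × ℕ => (p.1.headD []).headD 0 :=
    (h2.headD (Pol.const [])).headD (Pol.const 0)
  have h4 : Pol fun p : List (List ℕ) × ℕ => p.1.tail.tail := h2.tail.tail
  have h5 : Pol fun p : List (List ℕ) × ℕ => p.2 := Pol.snd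
  have h6 : Pol fun p : List (List ℕ) × ℕ =>
      alwaysGets k ((p.1.headD []).headD 0) p.1.tail.tail p.2 := pol_alwaysGets k h3 h4 h5
  exact Pol.all (l := fun t : List (List ℕ) => t.tail.headD [])
    (f := fun t : List (List ℕ) => alwaysGets k ((t.headD []).headD 0) t.tail.tail) h1 h6

theorem pol_answerSet (k : ℕ) : Pol (answerSet k) := by
  have h0 : Pol fun t : List (List ℕ) => t := Pol.id
  have h1 := h0.tail.headD (Pol.const [])
  have hk : Pol fun _ : List (List ℕ) => List.replicate k () := Pol.const _
  exact (pol_answerAll k).and ((h1.length_lt hk).not.and (hk.length_lt h1).not)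

end pol

end SeqAlloc

/-! ### Correctness of the auction -/

namespace SeqAlloc

/-- The state of the search for a cheapest slot, after the slots in `p`. -/
structure BidInv (w : ℕ) (st : List Slot × List Slot) (p : List Slot) : Prop where
  perm : (st.1 ++ st.2).Perm p
  length : st.1.length ≤ 1
  allowed : ∀ s ∈ st.1, w ∈ s.allowed
  least : ∀ s ∈ st.2, w ∈ s.allowed → ∃ s' ∈ st.1, s'.price.length ≤ s.price.length

theorem BidInv.step {w : ℕ} {st : List Slot × List Slot} {p : List Slot} (h : BidInv w st p)
    (s : Slot) : BidInv w (bidStep w st s) (p ++ [s]) := by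
  have hlen := length_bidStep w st s h.length
  obtain ⟨b, r⟩ := st
  obtain ⟨h1, h2, h3, h4⟩ := h
  have hp : ((b ++ r) ++ [s]).Perm (p ++ [s]) := h1.append_right _
  have hp' : (s :: (b ++ r)).Perm (p ++ [s]) := (List.perm_append_singleton _ _).symm.trans hp
  revert hlen
  unfold bidStep
  repeat' rw [Bool.cond_decide]
  simp only at h2 h3 h4 hp'
  split_ifs with ha hb hc <;> intro hlen <;> rcases b with _ | ⟨b, _ | ⟨b', t⟩⟩ <;>
    simp [-Prod.forall, -Prod.exists] at *
  · refine ⟨?_, by simp, by simpa using ha, ?_⟩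
    · exact hp'
    · intro s' hs' hw
      refine ⟨s, by simp, ?_⟩
      rcases List.mem_cons.1 hs' with rfl | hs'
      · exact hb.le
      · exact hb.le.trans (h4 s' hs' hw)
  · refine ⟨?_, by simp, by simpa using h3, ?_⟩
    · exact (List.Perm.swap _ _ _).trans hp'
    · intro s' hs' hw
      refine ⟨b, by simp, ?_⟩
      rcases List.mem_cons.1 hs' with rfl | hs'
      · exact hb
      · exact h4 s' hs' hw
  · refine ⟨hp', by simp, by simpa using ha, ?_⟩
    intro s' hs' hw
    exact absurd hw (h4 s' hs')
  · refine ⟨hp', by simp, by simp, ?_⟩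
    intro s' hs' hw
    rcases List.mem_cons.1 hs' with rfl | hs'
    · exact absurd hw ha
    · exact absurd hw (h4 s' hs')
  · refine ⟨(List.Perm.swap _ _ _).trans hp', by simp, by simpa using h3, ?_⟩
    intro s' hs' hw
    rcases List.mem_cons.1 hs' with rfl | hs'
    · exact absurd hw ha
    · exact ⟨b, by simp, h4 s' hs' hw⟩

theorem BidInv.foldl {w : ℕ} (l : List Slot) {st : List Slot × List Slot} {p : List Slot}
    (h : BidInv w st p) : BidInv w (l.foldl (bidStep w) st) (p ++ l) := by
  induction l generalizing st p with
  | nil => simpa using h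
  | cons s l ih => simpa using ih (h.step s)

/-- A bid moves slots around in the list, so the auction is analysed up to permutation of the slots.
-/
theorem bid_spec (w : ℕ) (l : List Slot) :
    ((∀ s ∈ l, w ∉ s.allowed) ∧ (bid w l).Perm l) ∨
    ∃ s r, l.Perm (s :: r) ∧ w ∈ s.allowed ∧
      (∀ s' ∈ l, w ∈ s'.allowed → s.price.length ≤ s'.price.length) ∧
      (bid w l).Perm (s.assign w :: r) := by
  have h := BidInv.foldl (w := w) l (st := ([], [])) (p := []) ⟨by simp, by simp, by simp, by simp⟩
  rw [List.nil_append] at h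
  rw [bid]
  obtain ⟨h1, h2, h3, h4⟩ := h
  generalize l.foldl (bidStep w) ([], []) = st at *
  obtain ⟨b, r⟩ := st
  rcases b with _ | ⟨b, _ | ⟨b', t⟩⟩
  · left
    refine ⟨fun s hs hw => ?_, by simpa using h1⟩
    have := h4 s (h1.mem_iff.2 hs) hw
    simp at this
  · right
    refine ⟨b, r, h1.symm, h3 b (by simp), fun s hs hw => ?_, by simp⟩
    rcases List.mem_cons.1 (h1.mem_iff.2 hs) with rfl | hs
    · exact le_rfl
    · simpa using h4 s hs hw
  · simp at h2

theorem Slot.owner_assign (w : ℕ) (s : Slot) : Slot.owner (s.assign w) = [w] := rfl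

theorem Slot.length_price_assign (w : ℕ) (s : Slot) :
    (Slot.price (s.assign w)).length = s.price.length + 1 := rfl

/-- The items assigned to the slots. -/
def owners (l : List Slot) : List ℕ := l.flatMap Slot.owner

/-- The invariant of the auction. -/
structure AuctionInv (W : List ℕ) (l : List Slot) : Prop where
  owner_le : ∀ s ∈ l, s.owner.length ≤ 1
  -- A slot that has received a bid changes owner but never becomes vacant again.
  price_pos : ∀ s ∈ l, 0 < s.price.length → s.owner ≠ []
  nodup : (owners l).Nodup
  -- Approximate complementary slackness: an owner's slot costs at most one more than any slot
  -- allowed for it.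
  owner : ∀ s ∈ l, ∀ w ∈ s.owner, w ∈ W ∧ w ∈ s.allowed ∧
    ∀ s' ∈ l, w ∈ s'.allowed → s.price.length ≤ s'.price.length + 1

theorem AuctionInv.perm {W : List ℕ} {l l' : List Slot} (h : AuctionInv W l) (hp : l.Perm l') :
    AuctionInv W l' where
  owner_le s hs := h.owner_le s (hp.mem_iff.2 hs)
  price_pos s hs := h.price_pos s (hp.mem_iff.2 hs)
  nodup := (hp.flatMap_right _).nodup_iff.1 h.nodup
  owner s hs w hw := by
    obtain ⟨h1, h2, h3⟩ := h.owner s (hp.mem_iff.2 hs) w hw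
    exact ⟨h1, h2, fun s' hs' => h3 s' (hp.mem_iff.2 hs')⟩

/-- The slot was cheapest for `w`, so after the increment it is within one of the alternatives. For
the other owners one alternative only became more expensive. -/
theorem AuctionInv.assign {W : List ℕ} {s : Slot} {r : List Slot} (h : AuctionInv W (s :: r))
    {w : ℕ} (hw : w ∈ W) (hwo : w ∉ owners (s :: r)) (hws : w ∈ s.allowed)
    (hle : ∀ s' ∈ r, w ∈ s'.allowed → s.price.length ≤ s'.price.length) :
    AuctionInv W (s.assign w :: r) where
  owner_le s' hs' := by
    rcases List.mem_cons.1 hs' with rfl | hs'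
    · rw [Slot.owner_assign]; rfl
    · exact h.owner_le s' (by simp [hs'])
  price_pos s' hs' := by
    rcases List.mem_cons.1 hs' with rfl | hs'
    · exact fun _ => List.cons_ne_nil _ _
    · exact h.price_pos s' (by simp [hs'])
  nodup := by
    have h1 := h.nodup
    simp only [owners, List.flatMap_cons, List.mem_append, not_or] at h1 hwo ⊢
    exact List.nodup_cons.2 ⟨hwo.2, (List.nodup_append.1 h1).2.1⟩
  owner s' hs' u hu := by
    rcases List.mem_cons.1 hs' with rfl | hs'
    · have : u = w := by rw [Slot.owner_assign] at hu; exact List.mem_singleton.1 hu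
      subst this
      refine ⟨hw, hws, fun s'' hs'' hus => ?_⟩
      rcases List.mem_cons.1 hs'' with rfl | hs''
      · omega
      · have := hle s'' hs'' hus
        rw [Slot.length_price_assign]
        omega
    · obtain ⟨h1, h2, h3⟩ := h.owner s' (by simp [hs']) u hu
      refine ⟨h1, h2, fun s'' hs'' hus => ?_⟩
      rcases List.mem_cons.1 hs'' with rfl | hs''
      · have := h3 s (by simp) hus
        simp only [Slot.assign, Slot.price, List.length_cons] at this ⊢
        omega
      · exact h3 s'' (by simp [hs'']) hus

/-- The part of the slots that does not change. -/
def Slot.static (s : Slot) : ℕ × List ℕ := (s.agent, s.allowed)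

/-- The sum of all prices. -/
def totalPrice (l : List Slot) : ℕ := (l.map fun s => s.price.length).sum

theorem mem_unassigned {W : List ℕ} {l : List Slot} {w : ℕ} :
    w ∈ unassigned W l ↔ w ∈ W ∧ w ∉ owners l := by
  simp [unassigned, owners]

theorem auctionStep_inv {W : List ℕ} {l : List Slot} (h : AuctionInv W l) :
    AuctionInv W (auctionStep W l) ∧
      ((auctionStep W l).map Slot.static).Perm (l.map Slot.static) := by
  rw [auctionStep, Bool.cond_decide]
  split_ifs with hu
  · rcases hu' : unassigned W l with _ | ⟨w, u⟩
    · simp [hu'] at hu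
    · obtain ⟨hw, hwo⟩ := mem_unassigned.1 (hu' ▸ List.mem_cons_self : w ∈ unassigned W l)
      rw [List.headD_cons]
      rcases bid_spec w l with ⟨-, h1⟩ | ⟨s, r, h1, h2, h3, h4⟩
      · exact ⟨h.perm h1.symm, h1.map _⟩
      · refine ⟨((h.perm h1).assign hw (fun hm => hwo ?_) h2 fun s' hs' =>
          h3 s' (h1.mem_iff.2 (by simp [hs']))).perm h4.symm, ?_⟩
        · exact (h1.flatMap_right Slot.owner).mem_iff.2 hm
        · exact (h4.map _).trans (h1.map Slot.static).symm
  · exact ⟨h, List.Perm.refl _⟩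

theorem auction_inv {W : List ℕ} (T : List ℕ) {l : List Slot} (h : AuctionInv W l) :
    AuctionInv W (T.foldl (fun l _ => auctionStep W l) l) ∧
      ((T.foldl (fun l _ => auctionStep W l) l).map Slot.static).Perm (l.map Slot.static) := by
  induction T generalizing l with
  | nil => exact ⟨h, List.Perm.refl _⟩
  | cons a T ih =>
    obtain ⟨h1, h2⟩ := auctionStep_inv h
    obtain ⟨h3, h4⟩ := ih h1
    exact ⟨h3, h4.trans h2⟩

theorem matchable_eq_true {T W : List ℕ} {l : List Slot} :
    matchable T W l = true ↔ unassigned W (T.foldl (fun l _ => auctionStep W l) l) = [] := by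
  simp [matchable]

theorem auctionInv_initial {W : List ℕ} {l : List Slot}
    (hl : ∀ s ∈ l, s.price = [] ∧ s.owner = []) : AuctionInv W l where
  owner_le s hs := by simp [(hl s hs).2]
  price_pos s hs := by simp [(hl s hs).1]
  nodup := by
    have : owners l = [] := by
      rw [owners, List.flatMap_eq_nil_iff]
      exact fun s hs => (hl s hs).2
    rw [this]
    exact List.nodup_nil
  owner s hs w hw := by simp [(hl s hs).2] at hw

theorem length_owners_le {l : List Slot} (h : ∀ s ∈ l, s.owner.length ≤ 1) :
    (owners l).length ≤ l.length := by
  induction l with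
  | nil => simp [owners]
  | cons s l ih =>
    have h1 := h s (by simp)
    have h2 := ih fun s hs => h s (by simp [hs])
    simp only [owners, List.flatMap_cons, List.length_append, List.length_cons] at *
    omega

theorem length_owners_eq {l : List Slot} (h : ∀ s ∈ l, s.owner.length = 1) :
    (owners l).length = l.length := by
  induction l with
  | nil => simp [owners]
  | cons s l ih =>
    have h1 := h s (by simp)
    have h2 := ih fun s hs => h s (by simp [hs])
    simp only [owners, List.flatMap_cons, List.length_append, List.length_cons] at *
    omega

/-- If the auction succeeds, the items are matched to the agents. -/
theorem exists_matching_of_matchable {T W : List ℕ} {l : List Slot} (hW : W.Nodup)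
    (hl : ∀ s ∈ l, s.price = [] ∧ s.owner = []) (h : matchable T W l = true) :
    ∃ g : ℕ → ℕ, (∀ w ∈ W, ∃ s ∈ l, s.agent = g w ∧ w ∈ s.allowed) ∧
      ∀ b, (W.filter fun w => decide (g w = b)).length ≤ l.countP fun s => decide (s.agent = b) := by
  classical
  rw [matchable_eq_true] at h
  obtain ⟨h1, h2⟩ := auction_inv T (auctionInv_initial (W := W) hl)
  generalize T.foldl (fun l _ => auctionStep W l) l = l' at *
  have h3 : ∀ w ∈ W, ∃ s ∈ l', w ∈ s.owner := by
    intro w hw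
    by_contra hc
    have : w ∈ unassigned W l' := mem_unassigned.2 ⟨hw, fun hm => hc (by
      simpa [owners] using hm)⟩
    simp [h] at this
  choose! f hf hfo using h3
  refine ⟨fun w => (f w).agent, fun w hw => ?_, fun b => ?_⟩
  · have h4 : (f w).static ∈ l.map Slot.static := h2.mem_iff.1 (List.mem_map_of_mem (hf w hw))
    obtain ⟨s, hs, e⟩ := List.mem_map.1 h4
    rw [Slot.static, Slot.static, Prod.mk.injEq] at e
    exact ⟨s, hs, e.1, e.2 ▸ (h1.owner _ (hf w hw) w (hfo w hw)).2.1⟩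
  · have h4 : l.countP (fun s => decide (s.agent = b)) =
        (l'.filter fun s => decide (s.agent = b)).length := by
      have h5 := h2.countP_eq (fun p => decide (p.1 = b))
      rw [List.countP_map, List.countP_map] at h5
      rw [← List.countP_eq_length_filter]
      exact h5.symm
    rw [h4]
    -- The items given to `b` own distinct slots of `b`: each slot has at most one owner.
    refine le_trans ?_ (length_owners_le fun s hs => h1.owner_le s (List.mem_of_mem_filter hs))
    refine (List.Nodup.subperm (hW.filter _) fun w hw => ?_).length_le
    have hw' := List.mem_filter.1 hw
    exact List.mem_flatMap.2 ⟨f w, List.mem_filter.2 ⟨hf w hw'.1, hw'.2⟩, hfo w hw'.1⟩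

/-- The number of slots whose price is at least `j`. -/
def countPrice (l : List Slot) (j : ℕ) : ℕ := (l.filter fun s => decide (j ≤ s.price.length)).length

theorem AuctionInv.length_owners_filter {W : List ℕ} {l : List Slot} (h : AuctionInv W l) {j : ℕ}
    (hj : 1 ≤ j) :
    (owners (l.filter fun s => decide (j ≤ s.price.length))).length = countPrice l j := by
  refine length_owners_eq fun s hs => ?_
  obtain ⟨h1, h2⟩ := List.mem_filter.1 hs
  have h3 := h.owner_le s h1
  have h4 := h.price_pos s h1 (by simp at h2; omega)
  have := List.length_pos_iff.2 h4
  omega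

theorem owners_filter_sublist (l : List Slot) (p : Slot → Bool) :
    (owners (l.filter p)).Sublist (owners l) := by
  induction l with
  | nil => simp [owners]
  | cons s l ih =>
    rw [List.filter_cons]
    split_ifs
    · exact (List.Sublist.refl _).append ih
    · exact ih.trans (List.sublist_append_right _ _)

/-- Slots with positive price have distinct owners in `W`, and the unassigned `w` is not among them.
-/
theorem AuctionInv.countPrice_lt {W : List ℕ} {l : List Slot} (h : AuctionInv W l) {w : ℕ}
    (hw : w ∈ W) (hwo : w ∉ owners l) : countPrice l 1 < W.length := by
  rw [← h.length_owners_filter le_rfl]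
  set O := owners (l.filter fun s => decide (1 ≤ s.price.length))
  have hs : O.Sublist (owners l) := owners_filter_sublist _ _
  have : (w :: O).Subperm W := by
    refine List.Nodup.subperm (List.nodup_cons.2 ⟨fun hm => hwo (hs.subset hm),
      h.nodup.sublist hs⟩) fun u hu => ?_
    rcases List.mem_cons.1 hu with rfl | hu
    · exact hw
    · obtain ⟨s, hs', hus⟩ := List.mem_flatMap.1 (hs.subset hu)
      exact (h.owner s hs' u hus).1
  simpa using this.length_le

/-- If Hall's condition holds, an item without a slot is allowed in a cheap slot. -/
theorem AuctionInv.exists_cheap {W : List ℕ} {l : List Slot} (h : AuctionInv W l)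
    (hall : ∀ X : Finset ℕ, (∀ x ∈ X, x ∈ W) →
      X.card ≤ l.countP fun s => decide (∃ x ∈ X, x ∈ s.allowed)) {w : ℕ}
    (hw : w ∈ W) (hwo : w ∉ owners l) : ∃ s ∈ l, w ∈ s.allowed ∧ s.price.length < W.length := by
  by_contra! hc
  -- Take `w` together with the owners of slots of price at least `j + 1`. By slackness, and by the
  -- assumption on `w`, every slot allowed for one of them costs at least `j`; Hall's condition
  -- compares the two numbers.
  have key : ∀ j, 1 ≤ j → j ≤ W.length → countPrice l (j + 1) + 1 ≤ countPrice l j := by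
    intro j hj hjW
    set O := owners (l.filter fun s => decide (j + 1 ≤ s.price.length)) with hO
    have hs : O.Sublist (owners l) := owners_filter_sublist _ _
    have hnd : (w :: O).Nodup :=
      List.nodup_cons.2 ⟨fun hm => hwo (hs.subset hm), h.nodup.sublist hs⟩
    have hcard : (w :: O).toFinset.card = countPrice l (j + 1) + 1 := by
      rw [List.toFinset_card_of_nodup hnd, List.length_cons, hO, h.length_owners_filter (by omega)]
    rw [← hcard]
    refine (hall _ fun x hx => ?_).trans ?_
    · rcases List.mem_cons.1 (List.mem_toFinset.1 hx) with rfl | hx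
      · exact hw
      · obtain ⟨s, hs', hxs⟩ := List.mem_flatMap.1 (hs.subset hx)
        exact (h.owner s hs' x hxs).1
    · rw [countPrice, ← List.countP_eq_length_filter]
      refine List.countP_mono_left fun s hs' hx => ?_
      simp only [decide_eq_true_eq] at hx ⊢
      obtain ⟨x, hx, hxs⟩ := hx
      rcases List.mem_cons.1 (List.mem_toFinset.1 hx) with rfl | hx
      · exact hjW.trans (hc s hs' hxs)
      · obtain ⟨s₂, hs₂, hxs₂⟩ := List.mem_flatMap.1 hx
        obtain ⟨h1, h2⟩ := List.mem_filter.1 hs₂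
        have := (h.owner s₂ h1 x hxs₂).2.2 s hs' hxs
        simp only [decide_eq_true_eq] at h2
        omega
  -- Descending from level `|W| + 1` to level `1` gives at least `|W|` slots of positive price,
  -- contrary to `countPrice_lt`.
  have key2 : ∀ i, i ≤ W.length → i ≤ countPrice l (W.length + 1 - i) := by
    intro i
    induction i with
    | zero => intro _; exact Nat.zero_le _
    | succ i ih =>
      intro hi
      have h1 := ih (by omega)
      have h2 := key (W.length + 1 - (i + 1)) (by omega) (by omega)
      have e : W.length + 1 - (i + 1) + 1 = W.length + 1 - i := by omega
      rw [e] at h2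
      omega
  have h1 := key2 W.length le_rfl
  have h2 := h.countPrice_lt hw hwo
  have e : W.length + 1 - W.length = 1 := by omega
  rw [e] at h1
  omega

theorem totalPrice_perm {l l' : List Slot} (h : l.Perm l') : totalPrice l = totalPrice l' :=
  (h.map _).sum_eq

theorem totalPrice_le {l : List Slot} {N : ℕ} (h : ∀ s ∈ l, s.price.length ≤ N) :
    totalPrice l ≤ countPrice l 1 * N := by
  induction l with
  | nil => simp [totalPrice]
  | cons s l ih =>
    have h1 := h s (by simp)
    have h2 := ih fun s hs => h s (by simp [hs])
    simp only [totalPrice, countPrice, List.map_cons, List.sum_cons, List.filter_cons] at *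
    split_ifs with h3
    · rw [List.length_cons, Nat.succ_mul]
      omega
    · simp only [decide_eq_true_eq, not_le, Nat.lt_one_iff] at h3
      omega

/-- The winning slot costs no more than the cheap slot from `exists_cheap`, so its raised price is
still at most `|W|`. -/
theorem auctionStep_progress {W : List ℕ} {l : List Slot} (h : AuctionInv W l)
    (hall : ∀ X : Finset ℕ, (∀ x ∈ X, x ∈ W) →
      X.card ≤ l.countP fun s => decide (∃ x ∈ X, x ∈ s.allowed))
    (hN : ∀ s ∈ l, s.price.length ≤ W.length) (hu : unassigned W l ≠ []) :
    totalPrice (auctionStep W l) = totalPrice l + 1 ∧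
      ∀ s ∈ auctionStep W l, s.price.length ≤ W.length := by
  rw [auctionStep, Bool.cond_decide, List.length_nil, if_pos (List.length_pos_iff.2 hu)]
  obtain ⟨w, u, hu'⟩ := List.exists_cons_of_ne_nil hu
  obtain ⟨hw, hwo⟩ := mem_unassigned.1 (hu' ▸ List.mem_cons_self : w ∈ unassigned W l)
  rw [hu', List.headD_cons]
  obtain ⟨s₀, h₀, hws₀, hlt⟩ := h.exists_cheap hall hw hwo
  rcases bid_spec w l with ⟨h1, -⟩ | ⟨s, r, h1, h2, h3, h4⟩
  · exact absurd hws₀ (h1 s₀ h₀)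
  · constructor
    · rw [totalPrice_perm h4, totalPrice_perm h1]
      simp only [totalPrice, List.map_cons, List.sum_cons, Slot.assign, Slot.price,
        List.length_cons]
      omega
    · intro s' hs'
      rcases List.mem_cons.1 (h4.mem_iff.1 hs') with rfl | hs'
      · have := h3 s₀ h₀ hws₀
        rw [Slot.length_price_assign]
        omega
      · exact hN s' (h1.mem_iff.2 (by simp [hs']))

theorem auctionStep_of_unassigned {W : List ℕ} {l : List Slot} (h : unassigned W l = []) :
    auctionStep W l = l := by
  simp [auctionStep, h]

theorem auction_of_unassigned {W : List ℕ} (T : List ℕ) {l : List Slot} (h : unassigned W l = []) :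
    T.foldl (fun l _ => auctionStep W l) l = l := by
  induction T with
  | nil => rfl
  | cons a T ih => rw [List.foldl_cons, auctionStep_of_unassigned h, ih]

theorem auction_progress {W : List ℕ} (T : List ℕ) {l : List Slot} (h : AuctionInv W l)
    (hall : ∀ X : Finset ℕ, (∀ x ∈ X, x ∈ W) →
      X.card ≤ l.countP fun s => decide (∃ x ∈ X, x ∈ s.allowed))
    (hN : ∀ s ∈ l, s.price.length ≤ W.length) :
    unassigned W (T.foldl (fun l _ => auctionStep W l) l) = [] ∨
      (totalPrice (T.foldl (fun l _ => auctionStep W l) l) = totalPrice l + T.length ∧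
        ∀ s ∈ T.foldl (fun l _ => auctionStep W l) l, s.price.length ≤ W.length) := by
  induction T generalizing l with
  | nil => exact Or.inr ⟨rfl, hN⟩
  | cons a T ih =>
    rw [List.foldl_cons]
    by_cases hu : unassigned W l = []
    · left
      rw [auctionStep_of_unassigned hu, auction_of_unassigned T hu, hu]
    · obtain ⟨h1, h2⟩ := auctionStep_progress h hall hN hu
      obtain ⟨h3, h4⟩ := auctionStep_inv h
      rcases ih h3 (fun X hX => (hall X hX).trans_eq (by
          have := h4.countP_eq (fun p => decide (∃ x ∈ X, x ∈ p.2))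
          rw [List.countP_map, List.countP_map] at this
          exact this.symm)) h2 with h5 | ⟨h5, h6⟩
      · exact Or.inl h5
      · right
        refine ⟨?_, h6⟩
        rw [h5, h1, List.length_cons]
        omega

/-- If Hall's condition holds, the auction succeeds. -/
theorem matchable_of_hall {T W : List ℕ} {l : List Slot} (hl : ∀ s ∈ l, s.price = [] ∧ s.owner = [])
    (hT : W.length * W.length ≤ T.length)
    (hall : ∀ X : Finset ℕ, (∀ x ∈ X, x ∈ W) →
      X.card ≤ l.countP fun s => decide (∃ x ∈ X, x ∈ s.allowed)) : matchable T W l = true := by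
  rw [matchable_eq_true]
  have h0 := auctionInv_initial (W := W) hl
  rcases auction_progress T h0 hall (fun s hs => by simp [(hl s hs).1]) with h | ⟨h1, h2⟩
  · exact h
  · by_contra hu
    obtain ⟨w, u, hu'⟩ := List.exists_cons_of_ne_nil hu
    obtain ⟨hw, hwo⟩ := mem_unassigned.1 (hu' ▸ List.mem_cons_self :
      w ∈ unassigned W (T.foldl (fun l _ => auctionStep W l) l))
    have h3 := (auction_inv T h0).1.countPrice_lt hw hwo
    have h4 := totalPrice_le h2
    -- If the auction never finished, the total price would be `|T|`, at least `|W| ^ 2`; but fewer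
    -- than `|W|` slots have a positive price, each at most `|W|`.
    have h5 := Nat.mul_lt_mul_of_pos_right h3 (by omega : 0 < W.length)
    omega

end SeqAlloc

/-! ### Sequential allocation -/

namespace SeqAlloc

section favourite
variable {m : ℕ} {Q : Equiv.Perm (Fin m)} {S S' : Finset (Fin m)} {c d : Fin m}

theorem mem_prefList (Q : Equiv.Perm (Fin m)) (c : Fin m) : c ∈ prefList Q := by
  rw [prefList, List.mem_ofFn]
  exact Q.surjective c

theorem favourite_eq_none : favourite Q S = none ↔ S = ∅ := by
  rw [favourite, List.find?_eq_none, Finset.eq_empty_iff_forall_notMem]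
  simp [mem_prefList]

theorem favourite_eq_some : favourite Q S = some c ↔ c ∈ S ∧ ∀ d ∈ S, Q.symm c ≤ Q.symm d := by
  rw [favourite, List.find?_eq_some_iff_getElem]
  simp only [decide_eq_true_eq, prefList, List.getElem_ofFn, List.length_ofFn]
  refine and_congr_right fun hc => ⟨?_, fun h => ?_⟩
  · rintro ⟨i, hi, rfl, h⟩ d hd
    rw [Equiv.symm_apply_apply]
    by_contra! hlt
    have := h (Q.symm d) hlt
    simp [hd] at this
  · refine ⟨Q.symm c, (Q.symm c).2, by simp, fun j hj => ?_⟩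
    simp only [Bool.not_eq_eq_eq_not, Bool.not_true, decide_eq_false_iff_not]
    intro hm
    have := h _ hm
    rw [Equiv.symm_apply_apply, Fin.le_def] at this
    simp at this
    omega

theorem favourite_mem (h : favourite Q S = some c) : c ∈ S := (favourite_eq_some.1 h).1

theorem favourite_le (h : favourite Q S = some c) (hd : d ∈ S) : Q.symm c ≤ Q.symm d :=
  (favourite_eq_some.1 h).2 d hd

theorem favourite_of_subset (hSS' : S ⊆ S') (h : favourite Q S' = some c) (hc : c ∈ S) :
    favourite Q S = some c :=
  favourite_eq_some.2 ⟨hc, fun _ hd => favourite_le h (hSS' hd)⟩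

theorem exists_favourite (hS : S.Nonempty) : ∃ c, favourite Q S = some c := by
  rw [← Option.isSome_iff_exists, Option.isSome_iff_ne_none, Ne, favourite_eq_none]
  exact hS.ne_empty

end favourite

/-! ### Items picked and items left over -/

variable {n m : ℕ} (P : Fin n → Equiv.Perm (Fin m))

/-- The items that are left over. -/
def remaining : List (Fin n) → Finset (Fin m) → Finset (Fin m)
  | [], S => S
  | a :: π, S =>
    match favourite (P a) S with
    | none => remaining π S
    | some c => remaining π (S.erase c)

variable {P}

theorem picks_cons_some {a : Fin n} {π : List (Fin n)} {S : Finset (Fin m)} {c : Fin m}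
    (h : favourite (P a) S = some c) : picks P (a :: π) S = (a, c) :: picks P π (S.erase c) := by
  rw [picks, h]

theorem remaining_cons_some {a : Fin n} {π : List (Fin n)} {S : Finset (Fin m)} {c : Fin m}
    (h : favourite (P a) S = some c) : remaining P (a :: π) S = remaining P π (S.erase c) := by
  rw [remaining, h]

theorem picks_cons_none {a : Fin n} {π : List (Fin n)} {S : Finset (Fin m)}
    (h : favourite (P a) S = none) : picks P (a :: π) S = picks P π S := by
  rw [picks, h]

theorem remaining_cons_none {a : Fin n} {π : List (Fin n)} {S : Finset (Fin m)}
    (h : favourite (P a) S = none) : remaining P (a :: π) S = remaining P π S := by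
  rw [remaining, h]

theorem remaining_subset (π : List (Fin n)) (S : Finset (Fin m)) : remaining P π S ⊆ S := by
  induction π generalizing S with
  | nil => exact subset_rfl
  | cons a π ih =>
    rcases h : favourite (P a) S with _ | c
    · rw [remaining_cons_none h]; exact ih S
    · rw [remaining_cons_some h]; exact (ih _).trans (Finset.erase_subset _ _)

theorem picks_append (π π' : List (Fin n)) (S : Finset (Fin m)) :
    picks P (π ++ π') S = picks P π S ++ picks P π' (remaining P π S) := by
  induction π generalizing S with
  | nil => rfl
  | cons a π ih =>
    rcases h : favourite (P a) S with _ | c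
    · rw [List.cons_append, picks_cons_none h, picks_cons_none h, remaining_cons_none h, ih]
    · rw [List.cons_append, picks_cons_some h, picks_cons_some h, remaining_cons_some h, ih,
        List.cons_append]

theorem remaining_append (π π' : List (Fin n)) (S : Finset (Fin m)) :
    remaining P (π ++ π') S = remaining P π' (remaining P π S) := by
  induction π generalizing S with
  | nil => rfl
  | cons a π ih =>
    rcases h : favourite (P a) S with _ | c
    · rw [List.cons_append, remaining_cons_none h, remaining_cons_none h, ih]
    · rw [List.cons_append, remaining_cons_some h, remaining_cons_some h, ih]

/-- An item left at the end was available at every turn, so each picker prefers her pick to it. -/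
theorem of_mem_picks {π : List (Fin n)} {S : Finset (Fin m)} {a : Fin n} {c : Fin m}
    (h : (a, c) ∈ picks P π S) : a ∈ π ∧ c ∈ S ∧ c ∉ remaining P π S ∧
      ∀ d ∈ remaining P π S, (P a).symm c < (P a).symm d := by
  induction π generalizing S with
  | nil => simp [picks] at h
  | cons b π ih =>
    rcases hf : favourite (P b) S with _ | e
    · rw [picks_cons_none hf] at h
      rw [remaining_cons_none hf]
      obtain ⟨h1, h2⟩ := ih h
      exact ⟨by simp [h1], h2⟩
    · rw [picks_cons_some hf] at h
      rw [remaining_cons_some hf]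
      rcases List.mem_cons.1 h with h | h
      · obtain ⟨rfl, rfl⟩ := Prod.mk.inj h
        have h1 : c ∉ remaining P π (S.erase c) := fun hc => by
          simpa using remaining_subset _ _ hc
        refine ⟨by simp, favourite_mem hf, h1, fun d hd => ?_⟩
        have h2 := Finset.mem_erase.1 (remaining_subset _ _ hd)
        exact lt_of_le_of_ne (favourite_le hf h2.2) fun e =>
          h2.1 ((P a).symm.injective e).symm
      · obtain ⟨h1, h2, h3⟩ := ih h
        exact ⟨by simp [h1], Finset.mem_of_mem_erase h2, h3⟩

theorem mem_remaining_or_picks (π : List (Fin n)) {S : Finset (Fin m)} {c : Fin m} (hc : c ∈ S) :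
    c ∈ remaining P π S ∨ ∃ a, (a, c) ∈ picks P π S := by
  induction π generalizing S with
  | nil => exact Or.inl hc
  | cons b π ih =>
    rcases hf : favourite (P b) S with _ | e
    · rw [picks_cons_none hf, remaining_cons_none hf]; exact ih hc
    · rw [picks_cons_some hf, remaining_cons_some hf]
      by_cases he : c = e
      · subst he; exact Or.inr ⟨b, by simp⟩
      · rcases ih (Finset.mem_erase.2 ⟨he, hc⟩) with h | ⟨a, h⟩
        · exact Or.inl h
        · exact Or.inr ⟨a, by simp [h]⟩

theorem card_remaining (π : List (Fin n)) (S : Finset (Fin m)) (h : π.length ≤ S.card) :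
    (remaining P π S).card + π.length = S.card := by
  induction π generalizing S with
  | nil => rfl
  | cons a π ih =>
    rw [List.length_cons] at h ⊢
    obtain ⟨c, hf⟩ := exists_favourite (Q := P a) (Finset.card_pos.1 (by omega : 0 < S.card))
    have h1 := Finset.card_erase_of_mem (favourite_mem hf)
    have h2 := ih (S.erase c) (by omega)
    rw [remaining_cons_some hf]
    omega

theorem card_picks (π : List (Fin n)) (S : Finset (Fin m)) (h : π.length ≤ S.card) (a : Fin n) :
    (Finset.univ.filter fun c => (a, c) ∈ picks P π S).card = π.count a := by
  induction π generalizing S with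
  | nil => simp [picks]
  | cons b π ih =>
    rw [List.length_cons] at h
    obtain ⟨c, hf⟩ := exists_favourite (Q := P b) (Finset.card_pos.1 (by omega : 0 < S.card))
    have h1 := Finset.card_erase_of_mem (favourite_mem hf)
    have h2 := ih (S.erase c) (by omega)
    rw [picks_cons_some hf]
    by_cases hab : b = a
    · subst hab
      rw [List.count_cons_self, ← h2]
      rw [← Finset.card_insert_of_notMem (a := c)]
      · congr 1
        ext d
        simp
      · simp only [Finset.mem_filter, Finset.mem_univ, true_and]
        intro hm
        simpa using (of_mem_picks hm).2.1
    · rw [List.count_cons_of_ne hab, ← h2]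
      congr 1
      ext d
      simp [Ne.symm hab]

/-- Fewer available items leave fewer items over. -/
theorem notMem_remaining_filter {a : Fin n} {o : Fin m} (π : List (Fin n)) {X Y : Finset (Fin m)}
    (hYX : Y ⊆ X) (hY : ∀ c ∈ Y, (P a).symm o ≤ (P a).symm c) (ho : (a, o) ∉ picks P π X)
    (hr : o ∉ remaining P π X) : o ∉ remaining P (π.filter (· ≠ a)) Y := by
  induction π generalizing X Y with
  | nil => exact fun h => hr (hYX h)
  | cons b π ih =>
    by_cases hoY : o ∈ Y
    swap
    · exact fun h => hoY (remaining_subset _ _ h)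
    obtain ⟨c, hf⟩ := exists_favourite (Q := P b) ⟨o, hYX hoY⟩
    rw [picks_cons_some hf] at ho
    rw [remaining_cons_some hf] at hr
    by_cases hb : b = a
    · subst hb
      rw [List.filter_cons_of_neg (by simp)]
      -- The omitted turn of `a` did not take an item of `Y`: as `o` is available and nothing in `Y`
      -- is better for `a`, she would have taken `o` itself.
      refine ih (fun d hd => Finset.mem_erase.2 ⟨?_, hYX hd⟩) hY (fun h => ho (by simp [h])) hr
      rintro rfl
      have : d = o := (P b).symm.injective
        (le_antisymm (favourite_le hf (hYX hoY)) (hY d hd))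
      subst this
      exact ho (by simp)
    · rw [List.filter_cons_of_pos (by simpa using hb)]
      obtain ⟨c', hf'⟩ := exists_favourite (Q := P b) ⟨o, hoY⟩
      rw [remaining_cons_some hf']
      -- If the pick from `X` lies in `Y`, it is also the pick from `Y`, so the inclusion persists.
      refine ih (fun d hd => ?_) (fun d hd => hY d (Finset.mem_of_mem_erase hd))
        (fun h => ho (by simp [h])) hr
      have hd' := Finset.mem_erase.1 hd
      refine Finset.mem_erase.2 ⟨?_, hYX hd'.2⟩
      rintro rfl
      rw [favourite_of_subset hYX hf hd'.2, Option.some.injEq] at hf'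
      exact hd'.1 hf'

theorem remaining_replicate {a : Fin n} {X U : Finset (Fin m)} (hUX : U ⊆ X)
    (hU : ∀ u ∈ U, ∀ d ∈ X, d ∉ U → (P a).symm u < (P a).symm d) :
    remaining P (List.replicate U.card a) X = X \ U := by
  induction h : U.card generalizing U X with
  | zero =>
    rw [Finset.card_eq_zero] at h
    simp [h, remaining]
  | succ r ih =>
    obtain ⟨u, hu⟩ := Finset.card_pos.1 (by omega : 0 < U.card)
    obtain ⟨c, hf⟩ := exists_favourite (Q := P a) ⟨u, hUX hu⟩
    have hcU : c ∈ U := by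
      by_contra hc
      exact absurd (favourite_le hf (hUX hu)) (not_le.2 (hU u hu c (favourite_mem hf) hc))
    have h1 := ih (X := X.erase c) (U := U.erase c) (Finset.erase_subset_erase _ hUX)
      (fun u hu d hd hdU => hU u (Finset.mem_of_mem_erase hu) d (Finset.mem_of_mem_erase hd)
        fun h => hdU (Finset.mem_erase.2 ⟨(Finset.mem_erase.1 hd).1, h⟩))
      (by rw [Finset.card_erase_of_mem hcU, h]; rfl)
    rw [List.replicate_succ, remaining_cons_some hf, h1]
    ext d
    simp only [Finset.mem_sdiff, Finset.mem_erase]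
    constructor
    · rintro ⟨⟨h2, h3⟩, h4⟩
      exact ⟨h3, fun h => h4 ⟨h2, h⟩⟩
    · rintro ⟨h2, h3⟩
      exact ⟨⟨fun h => h3 (h ▸ hcU), h2⟩, fun h => h3 h.2⟩

/-- Agents with different favourites do not interfere: each favourite is still available at its
turn. -/
theorem remaining_of_distinct_favourites (f : Fin n → Fin m) (qs : List (Fin n))
    (X : Finset (Fin m)) (hf : ∀ b ∈ qs, favourite (P b) X = some (f b)) (hnd : (qs.map f).Nodup) :
    remaining P qs X = X \ (qs.map f).toFinset := by
  induction qs generalizing X with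
  | nil => simp [remaining]
  | cons b qs ih =>
    rw [remaining_cons_some (hf b (by simp)), ih]
    · ext d
      simp only [Finset.mem_sdiff, Finset.mem_erase, List.map_cons, List.toFinset_cons,
        Finset.mem_insert, not_or]
      tauto
    · intro b' hb'
      have h1 := hf b' (by simp [hb'])
      refine favourite_of_subset (Finset.erase_subset _ _) h1
        (Finset.mem_erase.2 ⟨fun e => ?_, favourite_mem h1⟩)
      rw [List.map_cons, List.nodup_cons] at hnd
      exact hnd.1 (e ▸ List.mem_map_of_mem hb')
    · exact (List.nodup_cons.1 hnd).2

/-! ### Turning an assignment into a picking order -/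

/-- A map of a finite set to itself is bijective on some nonempty subset. -/
theorem exists_bijOn {α : Type} [DecidableEq α] {A : Finset α} (hA : A.Nonempty) {f : α → α}
    (hf : ∀ x ∈ A, f x ∈ A) : ∃ Q ⊆ A, Q.Nonempty ∧ Q.image f = Q ∧ Set.InjOn f Q := by
  -- A smallest nonempty invariant subset equals its image, since the image is again invariant and
  -- nonempty.
  obtain ⟨Q, hQ, hmin⟩ := Finset.exists_min_image
    (A.powerset.filter fun Q => Q.Nonempty ∧ Q.image f ⊆ Q) Finset.card
    ⟨A, by simp only [Finset.mem_filter, Finset.mem_powerset, subset_rfl, true_and]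
           exact ⟨hA, Finset.image_subset_iff.2 hf⟩⟩
  simp only [Finset.mem_filter, Finset.mem_powerset] at hQ hmin
  obtain ⟨h1, h2, h3⟩ := hQ
  have h4 := hmin (Q.image f) ⟨h3.trans h1, h2.image f, Finset.image_subset_image h3⟩
  have h5 : Q.image f = Q := Finset.eq_of_subset_of_card_le h3 h4
  exact ⟨Q, h1, h2, h5, Finset.injOn_of_card_image_eq (by rw [h5])⟩

/-- If every item of `W` can be given to an agent who prefers it to all items of `I`, then, in
some order, the agents pick all items of `W`, each agent as many as she is given. -/
theorem exists_order (W I : Finset (Fin m)) (hWI : Disjoint W I) (g : Fin m → Fin n)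
    (hg : ∀ c ∈ W, ∀ d ∈ I, (P (g c)).symm c < (P (g c)).symm d) :
    ∃ R : List (Fin n), (∀ b, R.count b = (W.filter fun c => g c = b).card) ∧
      remaining P R (W ∪ I) = I := by
  induction h : W.card using Nat.strong_induction_on generalizing W with
  | _ N ih =>
  rcases W.eq_empty_or_nonempty with rfl | ⟨w, hw⟩
  · exact ⟨[], by simp, by simp [remaining]⟩
  have : Nonempty (Fin m) := ⟨w⟩
  have hfav : ∀ b ∈ W.image g, ∃ c, favourite (P b) (W ∪ I) = some c ∧ c ∈ W := by
    intro b hb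
    obtain ⟨c, hc, rfl⟩ := Finset.mem_image.1 hb
    obtain ⟨e, he⟩ := exists_favourite (Q := P (g c)) (S := W ∪ I) ⟨c, Finset.mem_union_left _ hc⟩
    refine ⟨e, he, (Finset.mem_union.1 (favourite_mem he)).resolve_right fun heI => ?_⟩
    exact absurd (favourite_le he (Finset.mem_union_left _ hc)) (not_le.2 (hg c hc e heI))
  choose! f hf hfW using hfav
  -- Each owner `b` has her favourite `f b` in `W`, and `g (f b)` owns it. The agents of `Q`,
  -- permuted by this map, pick next; their favourites are distinct.
  obtain ⟨Q, hQA, hQ, hQim, hQinj⟩ := exists_bijOn (A := W.image g) ⟨g w, Finset.mem_image_of_mem _ hw⟩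
    (f := fun b => g (f b)) fun b hb => Finset.mem_image_of_mem _ (hfW b hb)
  have hfinj : Set.InjOn f Q := fun b hb b' hb' e => hQinj hb hb' (congrArg g e)
  have hsub : Q.image f ⊆ W := Finset.image_subset_iff.2 fun b hb => hfW b (hQA hb)
  have hlt : (W \ Q.image f).card < N := by
    rw [← h]
    refine Finset.card_lt_card (Finset.ssubset_iff_subset_ne.2 ⟨Finset.sdiff_subset, fun e => ?_⟩)
    obtain ⟨b, hb⟩ := hQ
    have h1 : f b ∈ W := hfW b (hQA hb)
    rw [← e] at h1
    exact (Finset.mem_sdiff.1 h1).2 (Finset.mem_image_of_mem _ hb)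
  obtain ⟨R, hR, hrem⟩ := ih _ hlt (W \ Q.image f) (hWI.mono_left Finset.sdiff_subset)
    (fun c hc => hg c (Finset.mem_sdiff.1 hc).1) rfl
  refine ⟨Q.toList ++ R, fun b => ?_, ?_⟩
  · rw [List.count_append, hR]
    -- As `g ∘ f` permutes `Q`, each agent of `Q` owns exactly one of the items picked in this
    -- round, and no other agent owns any.
    have h1 : Q.toList.count b = ((Q.image f).filter fun c => g c = b).card := by
      rw [List.Nodup.count (Finset.nodup_toList Q), Finset.filter_image,
        Finset.card_image_of_injOn (hfinj.mono (by intro x hx; exact (Finset.mem_filter.1 hx).1))]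
      simp only [Finset.mem_toList]
      split_ifs with hb
      · rw [← hQim] at hb
        obtain ⟨b', hb', e⟩ := Finset.mem_image.1 hb
        symm
        rw [Finset.card_eq_one]
        refine ⟨b', ?_⟩
        ext b''
        simp only [Finset.mem_filter, Finset.mem_singleton]
        constructor
        · rintro ⟨h1, h2⟩
          exact hQinj h1 hb' (h2.trans e.symm)
        · rintro rfl
          exact ⟨hb', e⟩
      · symm
        rw [Finset.card_eq_zero, Finset.filter_eq_empty_iff]
        intro b' hb' e
        exact hb (hQim ▸ Finset.mem_image.2 ⟨b', hb', e⟩)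
    rw [h1, ← Finset.card_union_of_disjoint, ← Finset.filter_union,
      Finset.union_sdiff_of_subset hsub]
    exact Finset.disjoint_filter_filter Finset.disjoint_sdiff
  · rw [remaining_append, remaining_of_distinct_favourites f Q.toList]
    · have e1 : (Q.toList.map f).toFinset = Q.image f := by
        ext d; simp
      have e2 : (W ∪ I) \ Q.image f = (W \ Q.image f) ∪ I := by
        rw [Finset.union_sdiff_distrib]
        congr 1
        exact Finset.sdiff_eq_self_of_disjoint (hWI.symm.mono_right hsub)
      rw [e1, e2, hrem]
    · intro b hb
      exact hf b (hQA (Finset.mem_toList.1 hb))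
    · refine List.Nodup.map_on (fun b hb b' hb' e => ?_) (Finset.nodup_toList Q)
      exact hfinj (Finset.mem_toList.1 hb) (Finset.mem_toList.1 hb') e

/-! ### Balanced policies and certificates for missing an item -/

section balanced
variable {n k : ℕ} {P : Fin n → Equiv.Perm (Fin (k * n))} {a : Fin n} {o : Fin (k * n)}

theorem IsBalancedPolicy.count {π : List (Fin n)} (h : IsBalancedPolicy (k * n) π) (b : Fin n) :
    π.count b = k := by
  have h1 : ∑ a : Fin n, π.count a = π.length := by
    have := Multiset.sum_count_eq_card (s := Finset.univ) (m := (π : Multiset (Fin n))) (by simp)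
    simpa using this
  rw [h.1, Finset.sum_congr rfl fun a _ => h.2 a b, Finset.sum_const, Finset.card_univ,
    Fintype.card_fin, smul_eq_mul, mul_comm] at h1
  exact Nat.eq_of_mul_eq_mul_right b.pos h1

theorem isBalancedPolicy_of_count {π : List (Fin n)} (h : ∀ b, π.count b = k) :
    IsBalancedPolicy (k * n) π := by
  refine ⟨?_, fun b b' => by rw [h, h]⟩
  have := Multiset.sum_count_eq_card (s := Finset.univ) (m := (π : Multiset (Fin n))) (by simp)
  simp only [Multiset.coe_count, h, Finset.sum_const, Finset.card_univ, Fintype.card_fin,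
    smul_eq_mul, Multiset.coe_card] at this
  rw [← this, mul_comm]

theorem exists_isBalancedPolicy (k n : ℕ) : ∃ π : List (Fin n), IsBalancedPolicy (k * n) π := by
  refine ⟨(List.finRange n).flatMap (List.replicate k), isBalancedPolicy_of_count fun b => ?_⟩
  have h : ∀ l : List (Fin n), (l.flatMap (List.replicate k)).count b = l.count b * k := by
    intro l
    induction l with
    | nil => simp
    | cons c l ih =>
      rw [List.flatMap_cons, List.count_append, ih, List.count_replicate, List.count_cons]
      by_cases hc : c = b <;> simp [hc, Nat.add_mul, add_comm]
  rw [h, List.Nodup.count (List.nodup_finRange n)]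
  simp

theorem mem_bundle {m : ℕ} {P : Fin n → Equiv.Perm (Fin m)} {π : List (Fin n)} {c : Fin m} :
    c ∈ bundle P π a ↔ (a, c) ∈ picks P π Finset.univ := by
  simp [bundle]

theorem card_bundle {π : List (Fin n)} (h : IsBalancedPolicy (k * n) π) :
    (bundle P π a).card = k := by
  rw [bundle, card_picks _ _ (by simp [h.1]), h.count]

/-- The items that `a` prefers to `o`. -/
def upper (P : Fin n → Equiv.Perm (Fin (k * n))) (a : Fin n) (o : Fin (k * n)) :
    Finset (Fin (k * n)) :=
  Finset.univ.filter fun c => (P a).symm c < (P a).symm o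

theorem mem_upper {c : Fin (k * n)} : c ∈ upper P a o ↔ (P a).symm c < (P a).symm o := by
  simp [upper]

theorem remaining_upper {r : ℕ} (hr : r ≤ (upper P a o).card) :
    o ∈ remaining P (List.replicate r a) Finset.univ := by
  have h1 : remaining P (List.replicate (upper P a o).card a) Finset.univ =
      Finset.univ \ upper P a o :=
    remaining_replicate (Finset.subset_univ _) fun u hu d _ hd =>
      lt_of_lt_of_le (mem_upper.1 hu) (not_lt.1 fun h => hd (mem_upper.2 h))
  have h2 : o ∈ remaining P (List.replicate (upper P a o).card a) Finset.univ := by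
    rw [h1]
    simp [mem_upper]
  rw [← Nat.add_sub_cancel' hr, List.replicate_add, remaining_append] at h2
  exact remaining_subset _ _ h2

/-- The allocation witnesses that `a` may get the items of `S`, without `o`, under a balanced
policy where she first picks all items that she prefers to `o`, and the other items of `S` last:
`g` gives each item not in `S` to an agent other than `a` who prefers it to these other items. -/
structure Avoids (P : Fin n → Equiv.Perm (Fin (k * n))) (a : Fin n) (o : Fin (k * n))
    (S : Finset (Fin (k * n))) (g : Fin (k * n) → Fin n) : Prop where
  card_le : S.card ≤ k
  notMem : o ∉ S
  upper_subset : upper P a o ⊆ S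
  ne : ∀ c ∉ S, g c ≠ a
  lt : ∀ c ∉ S, ∀ d ∈ S, d ∉ upper P a o → (P (g c)).symm c < (P (g c)).symm d
  fiber : ∀ b ≠ a, ((Finset.univ \ S).filter fun c => g c = b).card ≤ k

/-- The certificate is read off the normalised policy: `S` is `U` together with what the others
leave over, and `g` names the picker of every other item. -/
theorem exists_avoids {π : List (Fin n)} (hπ : IsBalancedPolicy (k * n) π)
    (ho : o ∉ bundle P π a) (hU : (upper P a o).card < k) : ∃ S g, Avoids P a o S g := by
  set U := upper P a o with hUdef
  set R := π.filter (· ≠ a) with hR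
  have hRlen : R.length + k = k * n := by
    have h1 := List.length_eq_countP_add_countP (fun b => decide (b ≠ a)) (l := π)
    rw [hπ.1, List.countP_eq_length_filter] at h1
    have h2 : π.countP (fun b => decide ¬decide (b ≠ a) = true) = k := by
      rw [← hπ.count a, List.count_eq_countP]
      refine List.countP_congr fun b _ => by simp
    rw [h2] at h1
    exact h1.symm
  have hcard : (Finset.univ \ U).card + U.card = k * n := by
    rw [Finset.card_sdiff_add_card_eq_card (Finset.subset_univ _)]
    simp
  have hle : R.length ≤ (Finset.univ \ U).card := by omega
  set I := remaining P R (Finset.univ \ U) with hI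
  have hIcard := card_remaining (P := P) R _ hle
  -- Under `π` all items are taken, `o` by an agent other than `a`; without the turns of `a` and the
  -- items of `U`, it is still taken.
  have hoI : o ∉ I := by
    refine notMem_remaining_filter π (Finset.subset_univ _) (fun c hc => ?_)
      (fun h => ho (mem_bundle.2 h)) ?_
    · have := (Finset.mem_sdiff.1 hc).2
      rw [hUdef, mem_upper, not_lt] at this
      exact this
    · have h1 := card_remaining (P := P) π Finset.univ (by simp [hπ.1])
      have h2 : (remaining P π Finset.univ).card = 0 := by
        rw [hπ.1] at h1
        simpa using h1
      rw [Finset.card_eq_zero.1 h2]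
      simp
  have hg : ∀ c ∉ U ∪ I, ∃ b, (b, c) ∈ picks P R (Finset.univ \ U) := by
    intro c hc
    rw [Finset.mem_union, not_or] at hc
    exact (mem_remaining_or_picks R (by simpa using hc.1)).resolve_left hc.2
  have : Nonempty (Fin n) := ⟨a⟩
  choose! g hg using hg
  refine ⟨U ∪ I, g, ⟨?_, ?_, Finset.subset_union_left, fun c hc => ?_, fun c hc d hd hdU => ?_,
    fun b hb => ?_⟩⟩
  · refine (Finset.card_union_le _ _).trans ?_
    rw [← hI] at hIcard
    omega
  · rw [Finset.mem_union, not_or]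
    exact ⟨by simp [hUdef, mem_upper], hoI⟩
  · have := (of_mem_picks (hg c hc)).1
    rw [hR, List.mem_filter] at this
    simpa using this.2
  · exact (of_mem_picks (hg c hc)).2.2.2 d ((Finset.mem_union.1 hd).resolve_left hdU)
  · have h1 := card_picks (P := P) R _ hle b
    have h2 : R.count b = k := by
      rw [hR, List.count_filter (by simpa using hb), hπ.count]
    rw [h2] at h1
    refine le_of_le_of_eq (Finset.card_le_card fun c hc => by
      simp only [Finset.mem_filter, Finset.mem_sdiff, Finset.mem_univ, true_and] at hc ⊢
      rw [← hc.2]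
      exact hg c hc.1) h1

/-- The upper bounds `k` for `S` and for the `n - 1` fibres add up to `k * n`, the number of items,
so all are attained. Hence inequalities suffice in `Avoids`. -/
theorem Avoids.card_fiber {S : Finset (Fin (k * n))} {g : Fin (k * n) → Fin n}
    (h : Avoids P a o S g) :
    S.card = k ∧ ∀ b ≠ a, ((Finset.univ \ S).filter fun c => g c = b).card = k := by
  have h1 : (Finset.univ \ S).card + S.card = k * n := by
    rw [Finset.card_sdiff_add_card_eq_card (Finset.subset_univ _)]
    simp
  have h2 : (Finset.univ \ S).card =
      ∑ b ∈ Finset.univ.erase a, ((Finset.univ \ S).filter fun c => g c = b).card :=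
    Finset.card_eq_sum_card_fiberwise fun c hc =>
      Finset.mem_coe.2 (Finset.mem_erase.2 ⟨h.ne c (by simpa using hc), Finset.mem_univ _⟩)
  have h3 : ∀ b ∈ Finset.univ.erase a, ((Finset.univ \ S).filter fun c => g c = b).card ≤ k :=
    fun b hb => h.fiber b (Finset.mem_erase.1 hb).1
  have h4 : ∑ _b ∈ Finset.univ.erase a, k + k = k * n := by
    rw [Finset.sum_const, Finset.card_erase_of_mem (Finset.mem_univ _), Finset.card_univ,
      Fintype.card_fin, smul_eq_mul]
    have := a.pos
    obtain ⟨r, rfl⟩ : ∃ r, n = r + 1 := ⟨n - 1, by omega⟩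
    simp only [Nat.add_sub_cancel]
    ring
  have h5 := Finset.sum_le_sum h3
  have h6 := h.card_le
  have h7 := (Finset.sum_eq_sum_iff_of_le h3).1 (by omega)
  exact ⟨by omega, fun b hb => h7 b (Finset.mem_erase.2 ⟨hb, Finset.mem_univ _⟩)⟩

/-- First `a` takes `U`, then the others take everything outside `S` in the order from
`exists_order`, and `a` gets the rest of `S`. -/
theorem Avoids.exists_policy {S : Finset (Fin (k * n))} {g : Fin (k * n) → Fin n}
    (h : Avoids P a o S g) : ∃ π, IsBalancedPolicy (k * n) π ∧ o ∉ bundle P π a := by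
  obtain ⟨hS, hfib⟩ := h.card_fiber
  have hUS := h.upper_subset
  set U := upper P a o with hU
  have hUk : U.card ≤ k := (Finset.card_le_card hUS).trans h.card_le
  obtain ⟨R, hR, hrem⟩ := exists_order (P := P) (Finset.univ \ S) (S \ U)
    (Finset.sdiff_disjoint.mono_right Finset.sdiff_subset) g
    fun c hc d hd => h.lt c (Finset.mem_sdiff.1 hc).2 d (Finset.mem_sdiff.1 hd).1
      (Finset.mem_sdiff.1 hd).2
  have hRa : R.count a = 0 := by
    rw [hR, Finset.card_eq_zero, Finset.filter_eq_empty_iff]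
    exact fun c hc => h.ne c (Finset.mem_sdiff.1 hc).2
  have hfirst : remaining P (List.replicate U.card a) Finset.univ = Finset.univ \ U :=
    remaining_replicate (Finset.subset_univ _) fun u hu d _ hd =>
      lt_of_lt_of_le (mem_upper.1 hu) (not_lt.1 fun h => hd (mem_upper.2 h))
  have hunion : (Finset.univ \ S) ∪ (S \ U) = Finset.univ \ U := by
    ext c
    have := @hUS c
    simp only [Finset.mem_union, Finset.mem_sdiff, Finset.mem_univ, true_and]
    tauto
  refine ⟨List.replicate U.card a ++ (R ++ List.replicate (k - U.card) a),
    isBalancedPolicy_of_count fun b => ?_, fun ho => ?_⟩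
  · rw [List.count_append, List.count_append, List.count_replicate, List.count_replicate]
    by_cases hb : b = a
    · subst hb
      simp only [BEq.rfl, if_true]
      omega
    · have hb' : (a == b) = false := by simpa using Ne.symm hb
      rw [hb', hR, hfib b hb]
      simp
  · rw [mem_bundle, picks_append, picks_append, hfirst, ← hunion, hrem, List.mem_append,
      List.mem_append] at ho
    rcases ho with ho | ho | ho
    · have := (of_mem_picks ho).2.2.1
      rw [hfirst] at this
      simp [hU, mem_upper] at this
    · exact List.count_eq_zero.1 hRa (of_mem_picks ho).1
    · exact h.notMem (Finset.mem_sdiff.1 (of_mem_picks ho).2.1).1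

/-- If `a` has all her turns at the beginning, she spends them on items she prefers to `o`. -/
theorem exists_policy_of_le (hU : k ≤ (upper P a o).card) :
    ∃ π, IsBalancedPolicy (k * n) π ∧ o ∉ bundle P π a := by
  obtain ⟨π, hπ⟩ := exists_isBalancedPolicy k n
  refine ⟨List.replicate k a ++ π.filter (· ≠ a), isBalancedPolicy_of_count fun b => ?_,
    fun ho => ?_⟩
  · rw [List.count_append, List.count_replicate]
    by_cases hb : b = a
    · subst hb
      have : (π.filter (· ≠ b)).count b = 0 := List.count_eq_zero.2 (by simp)
      rw [this]
      simp
    · have hb' : (a == b) = false := by simpa using Ne.symm hb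
      rw [hb', List.count_filter (by simpa using hb), hπ.count]
      simp
  · rw [mem_bundle, picks_append, List.mem_append] at ho
    rcases ho with ho | ho
    · exact (of_mem_picks ho).2.2.1 (remaining_upper hU)
    · simpa using (of_mem_picks ho).1

/-- An agent always gets `o` iff `o` is among her `k` most preferred items and cannot be avoided. -/
theorem necessary_iff : (∀ π, IsBalancedPolicy (k * n) π → o ∈ bundle P π a) ↔
    (upper P a o).card < k ∧ ¬∃ S g, Avoids P a o S g := by
  constructor
  · intro h
    constructor
    · by_contra! hU
      obtain ⟨π, hπ, ho⟩ := exists_policy_of_le hU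
      exact ho (h π hπ)
    · rintro ⟨S, g, hS⟩
      obtain ⟨π, hπ, ho⟩ := hS.exists_policy
      exact ho (h π hπ)
  · rintro ⟨hU, h⟩ π hπ
    by_contra ho
    exact h (exists_avoids hπ ho hU)

end balanced

end SeqAlloc

/-! ### Correctness of the algorithm -/

namespace SeqAlloc

open PolyTime

theorem mem_takeWhile_iff {α : Type} {p : α → Bool} {l : List α} {x : α} :
    x ∈ l.takeWhile p ↔ ∃ i, ∃ h : i < l.length, l[i] = x ∧
      ∀ j, (hj : j ≤ i) → p (l[j]'(lt_of_le_of_lt hj h)) := by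
  induction l with
  | nil => simp
  | cons a l ih =>
    rw [List.takeWhile_cons]
    split_ifs with ha
    · rw [List.mem_cons, ih]
      constructor
      · rintro (rfl | ⟨i, hi, rfl, h⟩)
        · refine ⟨0, by simp, rfl, fun j hj => ?_⟩
          obtain rfl : j = 0 := by omega
          exact ha
        · refine ⟨i + 1, by simpa using hi, rfl, fun j hj => ?_⟩
          rcases j with _ | j
          · exact ha
          · exact h j (by omega)
      · rintro ⟨i, hi, rfl, h⟩
        rcases i with _ | i
        · exact Or.inl rfl
        · exact Or.inr ⟨i, by simpa using hi, rfl, fun j hj => h (j + 1) (by omega)⟩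
    · simp only [List.not_mem_nil, false_iff]
      rintro ⟨i, hi, -, h⟩
      exact ha (h 0 (Nat.zero_le _))

/-- The preference list, as a list of names. -/
def names {m : ℕ} (Q : Equiv.Perm (Fin m)) : List ℕ := (prefList Q).map Fin.val

section names
variable {m : ℕ} (Q : Equiv.Perm (Fin m))

theorem nodup_names : (names Q).Nodup := by
  refine List.Nodup.map Fin.val_injective ?_
  exact List.nodup_ofFn.2 Q.injective

theorem mem_names {c : ℕ} : c ∈ names Q ↔ ∃ d : Fin m, (d : ℕ) = c := by
  simp [names, mem_prefList]

theorem mem_takeWhile_names {p : ℕ → Bool} {c : Fin m} :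
    (c : ℕ) ∈ (names Q).takeWhile p ↔ ∀ d : Fin m, Q.symm d ≤ Q.symm c → p d := by
  rw [mem_takeWhile_iff]
  simp only [names, prefList, List.getElem_map, List.getElem_ofFn, List.length_map,
    List.length_ofFn]
  constructor
  · rintro ⟨i, hi, e, h⟩ d hd
    have e' : Q ⟨i, hi⟩ = c := Fin.ext e
    rw [← e', Equiv.symm_apply_apply] at hd
    simpa using h (Q.symm d) hd
  · intro h
    refine ⟨Q.symm c, (Q.symm c).2, by simp, fun j hj => h _ ?_⟩
    rw [Equiv.symm_apply_apply]
    exact hj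

end names

variable {n k : ℕ} (P : Fin n → Equiv.Perm (Fin (k * n))) (a : Fin n) (o : Fin (k * n))

/-- The rows start with distinct names, so only one of them contributes. -/
theorem prefsOf_profileTable : prefsOf a (profileTable P) = names (P a) := by
  have h : ∀ l : List (Fin n), l.Nodup → a ∈ l →
      prefsOf a (l.map fun b : Fin n => (b : ℕ) :: names (P b)) = names (P a) := by
    intro l hl ha
    have h0 : ∀ l : List (Fin n), a ∉ l →
        prefsOf a (l.map fun b : Fin n => (b : ℕ) :: names (P b)) = [] := by
      intro l hl
      rw [prefsOf, List.flatMap_eq_nil_iff]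
      intro r hr
      obtain ⟨b, hb, rfl⟩ := List.mem_map.1 hr
      have : (b : ℕ) ≠ a := fun e => hl (Fin.ext e ▸ hb)
      simp [this]
    induction l with
    | nil => simp at ha
    | cons b l ih =>
      rw [List.nodup_cons] at hl
      rw [List.map_cons, prefsOf, List.flatMap_cons]
      change _ ++ prefsOf a _ = _
      by_cases hb : a = b
      · subst hb
        rw [h0 l hl.1]
        simp
      · have : (b : ℕ) ≠ a := fun e => hb (Fin.ext e).symm
        rw [ih hl.2 (by simpa [hb] using ha)]
        simp [this]
  rw [← h (List.finRange n) (List.nodup_finRange n) (List.mem_finRange a), profileTable,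
    List.ofFn_eq_map]
  rfl

theorem mem_better {c : Fin (k * n)} :
    (c : ℕ) ∈ better a o (profileTable P) ↔ c ∈ upper P a o := by
  rw [better, prefsOf_profileTable, mem_takeWhile_names, mem_upper]
  simp only [Bool.not_eq_eq_eq_not, Bool.not_true, decide_eq_false_iff_not, Fin.val_inj]
  constructor
  · intro h
    by_contra! hle
    exact h o hle rfl
  · rintro h d hd rfl
    exact absurd hd (not_le.2 h)

theorem exists_of_mem_better {c : ℕ} (h : c ∈ better a o (profileTable P)) :
    ∃ d ∈ upper P a o, (d : ℕ) = c := by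
  have h1 := (List.takeWhile_prefix _).subset h
  rw [prefsOf_profileTable, mem_names] at h1
  obtain ⟨d, rfl⟩ := h1
  exact ⟨d, (mem_better P a o).1 h, rfl⟩

theorem length_better : (better a o (profileTable P)).length = (upper P a o).card := by
  have h1 : (better a o (profileTable P)).Nodup := by
    refine List.Nodup.sublist (List.takeWhile_prefix _).sublist ?_
    rw [prefsOf_profileTable]
    exact nodup_names _
  rw [← List.toFinset_card_of_nodup h1, ← Finset.card_image_of_injective _ Fin.val_injective]
  congr 1
  ext c
  rw [List.mem_toFinset, Finset.mem_image]
  constructor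
  · exact exists_of_mem_better P a o
  · rintro ⟨d, hd, rfl⟩
    exact (mem_better P a o).2 hd

/-- Entries may repeat, so a tuple may stand for a set of fewer than `k` items; `Avoids` allows for
this. -/
theorem mem_tuples {l : List ℕ} {r : ℕ} {s : List ℕ} :
    s ∈ tuples l r ↔ s.length = r ∧ ∀ x ∈ s, x ∈ l := by
  induction r generalizing s with
  | zero =>
    rw [tuples, List.mem_singleton, List.length_eq_zero_iff]
    constructor
    · rintro rfl; simp
    · exact fun h => h.1
  | succ r ih =>
    simp only [tuples, List.mem_flatMap, List.mem_map]
    constructor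
    · rintro ⟨x, hx, s, hs, rfl⟩
      obtain ⟨h1, h2⟩ := ih.1 hs
      exact ⟨by simp [h1], by simpa [hx] using h2⟩
    · rintro ⟨h1, h2⟩
      rcases s with _ | ⟨x, s⟩
      · simp at h1
      · exact ⟨x, h2 x (by simp), s, ih.2 ⟨by simpa using h1, fun y hy => h2 y (by simp [hy])⟩, rfl⟩

/-- A slot of the agent `b`. -/
def slotFor (I : List ℕ) (b : Fin n) : Slot :=
  ((b : ℕ), (names (P b)).takeWhile (fun c => !decide (c ∈ I)), [], [])

theorem mem_slotsOf {I : List ℕ} {s : Slot} (h : s ∈ slotsOf k a (profileTable P) I) :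
    ∃ b ≠ a, s = slotFor P I b := by
  obtain ⟨r, hr, hs⟩ := List.mem_flatMap.1 h
  rw [profileTable, List.mem_ofFn] at hr
  obtain ⟨b, rfl⟩ := hr
  by_cases hb : b = a
  · subst hb; simp at hs
  · have : (b : ℕ) ≠ a := fun e => hb (Fin.ext e)
    simp only [List.headD_cons, this, decide_false, cond_false, List.tail_cons] at hs
    exact ⟨b, hb, (List.mem_replicate.1 hs).2⟩

theorem countP_slotsOf (I : List ℕ) (p : Slot → Bool) :
    (slotsOf k a (profileTable P) I).countP p =
      ∑ b : Fin n, if b = a then 0 else if p (slotFor P I b) then k else 0 := by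
  rw [slotsOf, profileTable, List.countP_flatMap, List.map_ofFn, List.sum_ofFn]
  refine Finset.sum_congr rfl fun b _ => ?_
  by_cases hb : b = a
  · subst hb; simp
  · have : (b : ℕ) ≠ a := fun e => hb (Fin.ext e)
    simp only [Function.comp_apply, List.headD_cons, this, decide_false, cond_false,
      List.tail_cons, hb, if_false]
    rw [List.countP_replicate]
    rfl

theorem avoids_of_avoids {s : List ℕ} (hs : s.length ≤ k)
    (h : avoids k a o (profileTable P) s = true) : ∃ S g, Avoids P a o S g := by
  rw [avoids, Bool.and_eq_true, Bool.and_eq_true, prefsOf_profileTable] at h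
  obtain ⟨h1, h2, h3⟩ := h
  simp only [Bool.not_eq_eq_eq_not, Bool.not_true, decide_eq_false_iff_not] at h1
  rw [List.all_eq_true] at h2
  obtain ⟨g', hg', hfib⟩ := exists_matching_of_matchable ((nodup_names _).filter _)
    (fun s hs => by
      obtain ⟨b, -, rfl⟩ := mem_slotsOf P a hs
      exact ⟨rfl, rfl⟩) h3
  have hW : ∀ c : Fin (k * n), (c : ℕ) ∉ s →
      (c : ℕ) ∈ (names (P a)).filter fun c => !decide (c ∈ s) := fun c hc =>
    List.mem_filter.2 ⟨(mem_names _).2 ⟨c, rfl⟩, by simpa using hc⟩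
  have hg : ∀ c : Fin (k * n), (c : ℕ) ∉ s → ∃ b ≠ a, (b : ℕ) = g' c ∧
      ∀ d : Fin (k * n), (P b).symm d ≤ (P b).symm c →
        ¬((d : ℕ) ∈ s ∧ (d : ℕ) ∉ better a o (profileTable P)) := by
    intro c hc
    obtain ⟨sl, hsl, e, hc'⟩ := hg' c (hW c hc)
    obtain ⟨b, hb, rfl⟩ := mem_slotsOf P a hsl
    refine ⟨b, hb, e, fun d hd hm => ?_⟩
    have := (mem_takeWhile_names (P b)).1 hc' d hd
    simp [hm.1, hm.2] at this
  have : Nonempty (Fin n) := ⟨a⟩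
  choose! g hga hgg hgl using hg
  refine ⟨Finset.univ.filter fun c => (c : ℕ) ∈ s, g, ⟨?_, ?_, ?_, ?_, ?_, ?_⟩⟩
  · rw [← Finset.card_image_of_injective _ Fin.val_injective]
    refine le_trans (Finset.card_le_card (t := s.toFinset) fun c hc => ?_)
      ((List.toFinset_card_le s).trans hs)
    obtain ⟨d, hd, rfl⟩ := Finset.mem_image.1 hc
    simpa using hd
  · simpa using h1
  · intro c hc
    have := h2 c ((mem_better P a o).2 hc)
    simpa using this
  · intro c hc
    exact hga c (by simpa using hc)
  · intro c hc d hd hdU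
    by_contra! hle
    exact hgl c (by simpa using hc) d hle
      ⟨by simpa using hd, fun hm => hdU ((mem_better P a o).1 hm)⟩
  · intro b _
    have h4 := hfib b
    rw [countP_slotsOf] at h4
    -- An agent has at most `k` slots.
    have h5 : (∑ b' : Fin n, if b' = a then 0 else
        if decide ((slotFor P (s.filter fun c => !decide (c ∈ better a o (profileTable P))) b').agent
          = (b : ℕ)) = true then k else 0) ≤ k := by
      refine (Finset.sum_le_sum (g := fun b' => if b' = b then k else 0) fun b' _ => ?_).trans
        (by simp)
      split_ifs with e1 e2 e3 e4
      · exact Nat.zero_le _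
      · exact Nat.zero_le _
      · exact le_rfl
      · exact absurd (Fin.ext (of_decide_eq_true e3)) e4
      · exact Nat.zero_le _
      · exact Nat.zero_le _
    refine le_trans ?_ (h4.trans h5)
    rw [← Finset.card_image_of_injective _ Fin.val_injective,
      ← List.toFinset_card_of_nodup (((nodup_names _).filter _).filter _)]
    refine Finset.card_le_card fun c hc => ?_
    obtain ⟨d, hd, rfl⟩ := Finset.mem_image.1 hc
    simp only [Finset.mem_filter, Finset.mem_sdiff, Finset.mem_univ, true_and] at hd
    rw [List.mem_toFinset, List.mem_filter]
    refine ⟨hW d hd.1, ?_⟩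
    rw [← hgg d hd.1, hd.2]
    simp

/-- Hall's condition is checked agent by agent: at most `k` items of `X` are given to `b`, and if
there is one, it is allowed in all `k` slots of `b`. -/
theorem exists_tuple_of_avoids {S : Finset (Fin (k * n))} {g : Fin (k * n) → Fin n}
    (h : Avoids P a o S g) :
    ∃ s ∈ tuples (names (P a)) k, avoids k a o (profileTable P) s = true := by
  obtain ⟨hS, -⟩ := h.card_fiber
  have hmem : ∀ c : Fin (k * n), (c : ℕ) ∈ S.toList.map Fin.val ↔ c ∈ S := by
    intro c
    rw [List.mem_map]
    constructor
    · rintro ⟨d, hd, e⟩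
      exact Fin.ext e ▸ Finset.mem_toList.1 hd
    · exact fun hc => ⟨c, Finset.mem_toList.2 hc, rfl⟩
  refine ⟨S.toList.map Fin.val, mem_tuples.2 ⟨by simp [hS], fun x hx => ?_⟩, ?_⟩
  · obtain ⟨d, -, rfl⟩ := List.mem_map.1 hx
    exact (mem_names _).2 ⟨d, rfl⟩
  rw [avoids, Bool.and_eq_true, Bool.and_eq_true, prefsOf_profileTable]
  refine ⟨?_, ?_, ?_⟩
  · simp only [Bool.not_eq_eq_eq_not, Bool.not_true, decide_eq_false_iff_not]
    exact fun hm => h.notMem ((hmem o).1 hm)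
  · rw [List.all_eq_true]
    intro c hc
    obtain ⟨d, hd, rfl⟩ := exists_of_mem_better P a o hc
    exact decide_eq_true ((hmem d).2 (h.upper_subset hd))
  refine matchable_of_hall (fun s hs => ?_) ?_ fun X hX => ?_
  · obtain ⟨b, -, rfl⟩ := mem_slotsOf P a hs
    exact ⟨rfl, rfl⟩
  · have h1 : ((names (P a)).flatMap fun _ => names (P a)).length =
        (names (P a)).length * (names (P a)).length := by
      simp [List.length_flatMap]
    rw [h1]
    exact Nat.mul_le_mul (List.length_filter_le _ _) (List.length_filter_le _ _)
  · rw [countP_slotsOf]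
    set X' : Finset (Fin (k * n)) := Finset.univ.filter fun c => (c : ℕ) ∈ X with hX'
    have hXX' : X = X'.image Fin.val := by
      ext c
      rw [Finset.mem_image]
      constructor
      · intro hc
        obtain ⟨d, rfl⟩ := (mem_names _).1 (List.mem_filter.1 (hX c hc)).1
        exact ⟨d, by simpa [hX'] using hc, rfl⟩
      · rintro ⟨d, hd, rfl⟩
        simpa [hX'] using hd
    have hXS : ∀ c ∈ X', c ∉ S := by
      intro c hc hcS
      have h1 := (List.mem_filter.1 (hX c (by simpa [hX'] using hc))).2
      rw [decide_eq_true ((hmem c).2 hcS)] at h1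
      simp at h1
    rw [hXX', Finset.card_image_of_injective _ Fin.val_injective,
      Finset.card_eq_sum_card_fiberwise (f := g) (t := Finset.univ) fun c _ => by simp]
    refine Finset.sum_le_sum fun b _ => ?_
    rcases (X'.filter fun c => g c = b).eq_empty_or_nonempty with he | ⟨c, hc⟩
    · rw [he]
      exact Nat.zero_le _
    · obtain ⟨hcX, rfl⟩ := Finset.mem_filter.1 hc
      have hcS := hXS c hcX
      rw [if_neg (h.ne c hcS), if_pos]
      · refine le_trans (Finset.card_le_card fun d hd => ?_) (h.fiber (g c) (h.ne c hcS))
        obtain ⟨hd1, hd2⟩ := Finset.mem_filter.1 hd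
        exact Finset.mem_filter.2 ⟨by simpa using hXS d hd1, hd2⟩
      · refine decide_eq_true ⟨c, Finset.mem_image_of_mem _ hcX, ?_⟩
        refine (mem_takeWhile_names (P (g c))).2 fun d hd => ?_
        simp only [List.mem_filter, Bool.not_eq_eq_eq_not, Bool.not_true, decide_eq_false_iff_not,
          not_and, not_not]
        intro hdS
        by_contra hdU
        exact absurd hd (not_le.2 (h.lt c hcS d ((hmem d).1 hdS)
          fun hm => hdU ((mem_better P a o).2 hm)))

theorem alwaysGets_iff : alwaysGets k a (profileTable P) o = true ↔
    ∀ π, IsBalancedPolicy (k * n) π → o ∈ bundle P π a := by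
  rw [necessary_iff, alwaysGets, Bool.and_eq_true, length_better, List.length_replicate,
    decide_eq_true_eq, Bool.not_eq_true', ← Bool.not_eq_true, List.any_eq_true,
    prefsOf_profileTable]
  refine and_congr_right fun _ => not_congr ⟨?_, ?_⟩
  · rintro ⟨s, hs, h⟩
    exact avoids_of_avoids P a o (mem_tuples.1 hs).1.le h
  · rintro ⟨S, g, h⟩
    exact exists_tuple_of_avoids P a o h

/-- The table of an instance with an item. -/
def itemTable (x : ItemInstance k) : List (List ℕ) :=
  [(x.agent : ℕ)] :: [(x.item : ℕ)] :: profileTable x.profile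

/-- The table of an instance with a set of items. -/
def setTable (x : SetInstance k) : List (List ℕ) :=
  [(x.agent : ℕ)] :: (x.items.sort (· ≤ ·)).map Fin.val :: profileTable x.profile

theorem answerAll_itemTable (x : ItemInstance k) :
    answerAll k (itemTable x) = true ↔ NecessaryItem x := by
  have : answerAll k (itemTable x) = alwaysGets k x.agent (profileTable x.profile) x.item := by
    simp [answerAll, itemTable]
  rw [this, alwaysGets_iff]
  rfl

theorem answerAll_setTable (x : SetInstance k) :
    answerAll k (setTable x) = true ↔ NecessarySubset x := by
  have : answerAll k (setTable x) = ((x.items.sort (· ≤ ·)).map Fin.val).all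
      (alwaysGets k x.agent (profileTable x.profile)) := rfl
  rw [this, List.all_eq_true]
  simp only [List.mem_map, Finset.mem_sort, forall_exists_index, and_imp, forall_apply_eq_imp_iff₂,
    alwaysGets_iff]
  exact ⟨fun h π hπ c hc => h c hc π hπ, fun h c hc π hπ => h π hπ hc⟩

/-- Every bundle has `k` elements, so always being equal to the set means always containing it and
the set having size `k`. -/
theorem answerSet_setTable (x : SetInstance k) :
    answerSet k (setTable x) = true ↔ NecessarySet x := by
  have h1 : answerSet k (setTable x) = true ↔ NecessarySubset x ∧ x.items.card = k := by
    have h2 : (setTable x).tail.headD [] = (x.items.sort (· ≤ ·)).map Fin.val := rfl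
    rw [answerSet, Bool.and_eq_true, answerAll_setTable, Bool.and_eq_true, h2, List.length_map,
      Finset.length_sort, List.length_replicate]
    simp only [Bool.not_eq_eq_eq_not, Bool.not_true, decide_eq_false_iff_not, not_lt]
    rw [and_comm (a := k ≤ _), le_antisymm_iff]
  rw [h1]
  constructor
  · rintro ⟨h, hk⟩ π hπ
    exact (Finset.eq_of_subset_of_card_le (h π hπ) (by rw [hk, card_bundle hπ])).symm
  · intro h
    refine ⟨fun π hπ => (h π hπ).symm.subset, ?_⟩
    -- The size of the set is read off from one policy, so some balanced policy must exist.
    obtain ⟨π, hπ⟩ := exists_isBalancedPolicy k x.n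
    rw [← h π hπ, card_bundle hπ]

end SeqAlloc

theorem mainTheorem5 (k : ℕ) :
    SeqAlloc.InP SeqAlloc.encItemInstance
        (SeqAlloc.NecessaryItem : SeqAlloc.ItemInstance k → Prop) ∧
      SeqAlloc.InP SeqAlloc.encSetInstance
        (SeqAlloc.NecessarySet : SeqAlloc.SetInstance k → Prop) ∧
      SeqAlloc.InP SeqAlloc.encSetInstance
        (SeqAlloc.NecessarySubset : SeqAlloc.SetInstance k → Prop) :=
  ⟨PolyTime.inP _ _ SeqAlloc.pol_parse (SeqAlloc.pol_answerAll k) SeqAlloc.itemTable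
      (fun _ => SeqAlloc.enc_parse _) SeqAlloc.answerAll_itemTable,
    PolyTime.inP _ _ SeqAlloc.pol_parse (SeqAlloc.pol_answerSet k) SeqAlloc.setTable
      (fun _ => SeqAlloc.enc_parse _) SeqAlloc.answerSet_setTable,
    PolyTime.inP _ _ SeqAlloc.pol_parse (SeqAlloc.pol_answerAll k) SeqAlloc.setTable
      (fun _ => SeqAlloc.enc_parse _) SeqAlloc.answerAll_setTable⟩
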